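/- Let $K$ be a number field with ring of integers $\mathcal{O}$, let $\mathfrak{p}$ be a nonzero prime ideal of $\mathcal{O}$ with residue field $k = \mathcal{O}/\mathfrak{p}$ of odd characteristic, and set $q = \#k$. Let $g \ge 1$ be an integer with $q > 4g^2 - 2$, and let $f \in \mathcal{O}[x]$ be a polynomial of degree $2g+2$ that is squarefree as an element of $K[x]$. Let $C$ be the hyperelliptic curve of genus $g$ over $K$ with affine equation $y^2 = f(x)$, that is, the smooth projective curve given by the weighted homogeneous equation $Y^2 = F(X,Z)$, where $F(X,Z) = Z^{2g+2} f(X/Z)$ is the homogenization of $f$ as a binary form of degree $2g+2$, in the weighted projective plane in which $X$ and $Z$ have degree $1$ and $Y$ has degree $g+1$. Let $\bar{f} \in k[x]$ be the reduction of $f$ modulo $\mathfrak{p}$, and suppose that $\bar{f}$ is not of the form $c\,h(x)^2$ with a polynomial $h \in k[x]$ (where $h = 0$ is allowed, so that in particular $\bar{f} \ne 0$) and a non-square $c \in k^\times$. Then $C(K_{\mathfrak{p}}) \neq \emptyset$, where $K_{\mathfrak{p}}$ is the completion of $K$ at $\mathfrak{p}$. -/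

import Mathlib

open Polynomial
open scoped NumberField

/-- Weighted homogeneous coordinates over an extension `L` of `K` for the curve of genus `g` with
affine equation `y ^ 2 = f(x)`: triples `(X, Y, Z) ≠ (0, 0, 0)` in `L` with `Y ^ 2 = F(X, Z)`, where
`F(X, Z) = Z ^ (2g+2) * f(X / Z)` is the homogenization of `f` as a binary form of
degree `2g+2`. -/
@[ext]
structure HyperellipticCoords {K : Type*} [Field K] (g : ℕ) (f : K[X])
    (L : Type*) [Field L] [Algebra K L] where
  X : L
  Y : L
  Z : L
  ne_zero : ¬ (X = 0 ∧ Y = 0 ∧ Z = 0)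
  equation : Y ^ 2 = MvPolynomial.aeval ![X, Z] (f.homogenize (2 * g + 2))

/-- Two coordinate triples are equivalent if they differ by the action of `Lˣ` for which `X` and
`Z` have weight `1` and `Y` has weight `g + 1`. -/
def HyperellipticCoords.setoid {K : Type*} [Field K] (g : ℕ) (f : K[X])
    (L : Type*) [Field L] [Algebra K L] : Setoid (HyperellipticCoords g f L) where
  r P Q := ∃ t : Lˣ, Q.X = t * P.X ∧ Q.Y = (t : L) ^ (g + 1) * P.Y ∧ Q.Z = t * P.Z
  iseqv := by
    refine ⟨fun P => ⟨1, by simp⟩, ?_, ?_⟩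
    · rintro P Q ⟨t, hX, hY, hZ⟩
      refine ⟨t⁻¹, ?_, ?_, ?_⟩
      · rw [hX]; simp
      · rw [hY, ← mul_assoc, ← mul_pow]; simp
      · rw [hZ]; simp
    · rintro P Q R ⟨t, hX, hY, hZ⟩ ⟨s, hX', hY', hZ'⟩
      refine ⟨s * t, ?_, ?_, ?_⟩
      · rw [hX', hX]; simp [mul_assoc]
      · rw [hY', hY]; simp [mul_assoc, mul_pow]
      · rw [hZ', hZ]; simp [mul_assoc]

/-- The set `C(L)` of `L`-rational points of the smooth projective model `Y ^ 2 = F(X, Z)`, in the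
weighted projective plane with weights `(1, g + 1, 1)`, of the hyperelliptic curve
`C : y ^ 2 = f(x)` over `K` (for `f` squarefree of degree `2g+2`). -/
def HyperellipticPoints {K : Type*} [Field K] (g : ℕ) (f : K[X])
    (L : Type*) [Field L] [Algebra K L] : Type _ :=
  Quotient (HyperellipticCoords.setoid g f L)

/-! By Hensel's lemma it suffices that the reduced equation has a nonsingular solution over k, in
the affine chart or at infinity. Write the reduction as U h² with U squarefree, and let m be the
genus of y² = U(x). Without nonsingular points U(x) is a nonsquare away from the zeros of h, so S =
Σ χ(U(x)) ≤ -q + 2 deg h. The Hasse–Weil bound for U, with the contribution at infinity, then gives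
q + 1 ≤ 2m√q + 2(g - m), which 4g² ≤ q + 1 forbids. If U is constant, the reduction has the excluded
shape c h².

Hasse–Weil (`abs_sum_quadraticChar_eval_le_sqrt`) is proved by Stepanov's method. Over a field with
Q² elements, `stepanov_card_le` bounds the character sum by a poor constant times Q. The L-function
of a ↦ χ(Res(a, U)) is a polynomial of degree less than deg U, and the power sums of its inverse
roots ω are, up to sign, the character sums over the extensions of k (`mul_monicSum`,
`eulerPowerSum_resultantChar`). Along growing extensions the constant becomes irrelevant, so |ω| ≤
√q (`norm_le_of_norm_sum_pow_le`). When deg U is even, one ω equals ±1 and is split off. -/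

/-! ### Stepanov's method over finite fields of square order -/

/-- Squaring the relation and multiplying by f replaces f^M by f^Q, as Q = 2M + 1, and f^Q ≡ f(0)^Q
modulo X^Q. Only r₀ and t₀ survive modulo X^Q, and the bound on A turns r₀² f ≡ f(0)^Q t₀² into an
equality, which would make f a constant times a square unless r₀ = t₀ = 0. Dividing by X^Q continues
the induction. -/
theorem stepanov_injective {F : Type*} [Field F] (p s : ℕ) [Fact p.Prime] [CharP F p]
    (f : F[X]) (h0 : f.eval 0 ≠ 0) (hns : ∀ (c : F) (h : F[X]), f ≠ C c * h ^ 2)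
    (M A : ℕ) (hM : p ^ s = 2 * M + 1) (hA : 2 * A + f.natDegree ≤ p ^ s + 1)
    (J : ℕ) (r t : ℕ → F[X]) (hr : ∀ j, (r j).degree < A) (ht : ∀ j, (t j).degree < A)
    (h : ∑ j ∈ Finset.range J, (r j + t j * f ^ M) * X ^ (j * p ^ s) = 0) :
    ∀ j < J, r j = 0 ∧ t j = 0 := by
  induction J generalizing r t with
  | zero => simp
  | succ J ih =>
    set Q := p ^ s with hQ
    have key : r 0 = 0 ∧ t 0 = 0 := by
      rw [Finset.sum_range_succ'] at h
      set R := ∑ j ∈ Finset.range J, r (j + 1) * X ^ (j * Q) with hR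
      set T := ∑ j ∈ Finset.range J, t (j + 1) * X ^ (j * Q) with hT
      have h1 : (r 0 + X ^ Q * R) = - (t 0 + X ^ Q * T) * f ^ M := by
        have : ∑ j ∈ Finset.range J, (r (j + 1) + t (j + 1) * f ^ M) * X ^ ((j + 1) * Q)
            = X ^ Q * R + X ^ Q * T * f ^ M := by
          rw [hR, hT, Finset.mul_sum, Finset.mul_sum, Finset.sum_mul, ← Finset.sum_add_distrib]
          refine Finset.sum_congr rfl fun j _ => ?_
          ring
        rw [this] at h
        simp only [zero_mul, pow_zero, mul_one] at h
        linear_combination h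
      have h2 : (r 0 + X ^ Q * R) ^ 2 * f = (t 0 + X ^ Q * T) ^ 2 * f ^ Q := by
        rw [h1, hM]; ring
      have h3 : (X : F[X]) ^ Q ∣ f ^ Q - C (f.eval 0 ^ Q) := by
        rw [C_pow, hQ, ← sub_pow_char_pow]
        apply pow_dvd_pow_of_dvd
        rw [X_dvd_iff, coeff_sub, coeff_C_zero, coeff_zero_eq_eval_zero, sub_self]
      have h4 : (X : F[X]) ^ Q ∣ r 0 ^ 2 * f - C (f.eval 0 ^ Q) * t 0 ^ 2 := by
        obtain ⟨w, hw⟩ := h3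
        refine ⟨w * t 0 ^ 2 + (2 * t 0 * T + X ^ Q * T ^ 2) * f ^ Q
          - (2 * r 0 * R + X ^ Q * R ^ 2) * f, ?_⟩
        linear_combination h2 + t 0 ^ 2 * hw
      have hdeg : (r 0 ^ 2 * f - C (f.eval 0 ^ Q) * t 0 ^ 2).degree < (X ^ Q : F[X]).degree := by
        rw [degree_X_pow]
        have aux : ∀ u : F[X], u.degree < A → ∀ v : F[X], v.natDegree ≤ f.natDegree →
            (u ^ 2 * v).degree < Q := by
          intro u hu v hv
          by_cases hu0 : u = 0
          · subst hu0; simp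
          have hu' : u.natDegree < A := (natDegree_lt_iff_degree_lt hu0).2 hu
          refine degree_le_natDegree.trans_lt ?_
          have : (u ^ 2 * v).natDegree ≤ 2 * u.natDegree + v.natDegree :=
            natDegree_mul_le.trans (by rw [natDegree_pow])
          exact_mod_cast (by omega : (u ^ 2 * v).natDegree < Q)
        refine (degree_sub_le _ _).trans_lt (max_lt (aux _ (hr 0) f le_rfl) ?_)
        rw [mul_comm]
        exact aux _ (ht 0) _ (by simp)
      have h5 := eq_zero_of_dvd_of_degree_lt h4 hdeg
      have hc : f.eval 0 ^ Q ≠ 0 := pow_ne_zero _ h0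
      by_cases hr0 : r 0 = 0
      · refine ⟨hr0, ?_⟩
        rw [hr0] at h5
        simpa [hc, hr0, h0] using h5
      · exfalso
        have h6 : r 0 ^ 2 ∣ t 0 ^ 2 := by
          have : r 0 ^ 2 ∣ C (f.eval 0 ^ Q) * t 0 ^ 2 := ⟨f, by linear_combination -h5⟩
          rwa [(isUnit_C.2 hc.isUnit).dvd_mul_left] at this
        rw [UniqueFactorizationMonoid.pow_dvd_pow_iff_dvd two_ne_zero] at h6
        obtain ⟨w, hw⟩ := h6
        apply hns (f.eval 0 ^ Q) w
        apply mul_left_cancel₀ (pow_ne_zero 2 hr0)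
        rw [hw] at h5
        linear_combination h5
    have hX : ∑ j ∈ Finset.range J, (r (j + 1) + t (j + 1) * f ^ M) * X ^ (j * Q) = 0 := by
      rw [Finset.sum_range_succ', key.1, key.2] at h
      apply mul_left_cancel₀ (pow_ne_zero Q (X_ne_zero (R := F)))
      rw [mul_zero, Finset.mul_sum]
      simp only [zero_mul, add_zero] at h
      rw [← h]
      refine Finset.sum_congr rfl fun j _ => ?_
      ring
    intro j hj
    cases j with
    | zero => exact key
    | succ j =>
      exact ih (fun j => r (j + 1)) (fun j => t (j + 1)) (fun j => hr _)
        (fun j => ht _) hX j (by omega)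

/-- The set Z lies among the roots of an auxiliary polynomial P. Its coefficients are Q-th powers of
unknowns c, so y^(Q²) = y untwists them: on Z the value P(x)^Q f(x)^M equals that of a polynomial
E(c), linear in c and of degree less than N. There are 2JA unknowns and only N coefficients to kill,
so E(c) = 0 for some c ≠ 0, and `stepanov_injective` keeps P nonzero. -/
theorem stepanov_card_le {F : Type*} [Field F] [Fintype F] (p s : ℕ) [Fact p.Prime] [CharP F p]
    (f : F[X]) (h0 : f.eval 0 ≠ 0) (hns : ∀ (c : F) (h : F[X]), f ≠ C c * h ^ 2)
    (M A J : ℕ) (hM : p ^ s = 2 * M + 1) (hM0 : 0 < M) (hF : Fintype.card F = (p ^ s) ^ 2)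
    (hA : 2 * A + f.natDegree ≤ p ^ s + 1)
    (hdim : J + p ^ s * A + f.natDegree * M < 2 * (J * A)) (ε : F) (hε : ε ≠ 0)
    (Z : Finset F) (hZ : ∀ x ∈ Z, f.eval x ^ (M * (p ^ s + 1)) = ε) :
    Z.card ≤ A + f.natDegree * M + p ^ s * J := by
  set Q := p ^ s with hQ
  set N := J + Q * A + f.natDegree * M with hN
  let E : (Fin 2 × Fin J × Fin A → F) →ₗ[F] F[X] :=
    Fintype.linearCombination F (fun a : Fin 2 × Fin J × Fin A =>
      (if a.1 = 0 then f ^ M else C ε) * X ^ (a.2.1.1 + Q * a.2.2.1))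
  have hE : ∀ c, E c = ∑ j : Fin J, ∑ i : Fin A,
      (C (c (0, j, i)) * f ^ M + C ε * C (c (1, j, i))) * X ^ (j.1 + Q * i.1) := by
    intro c
    simp only [E, Fintype.linearCombination_apply, Fintype.sum_prod_type, Fin.sum_univ_two,
      ← Finset.sum_add_distrib]
    refine Finset.sum_congr rfl fun j _ => Finset.sum_congr rfl fun i _ => ?_
    simp [smul_eq_C_mul]
    ring
  let L : F[X] →ₗ[F] (Fin N → F) := LinearMap.pi fun n => lcoeff F n.1
  have hker : LinearMap.ker (L ∘ₗ E) ≠ ⊥ := by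
    apply LinearMap.ker_ne_bot_of_finrank_lt
    simpa [mul_assoc] using hdim
  obtain ⟨c, hcker, hc0⟩ := Submodule.exists_mem_ne_zero_of_ne_bot hker
  have hEc : E c = 0 := by
    have hdeg : (E c).degree < N := by
      rw [hE, degree_lt_iff_coeff_zero]
      intro n hn
      rw [finsetSum_coeff]
      refine Finset.sum_eq_zero fun j _ => ?_
      rw [finsetSum_coeff]
      refine Finset.sum_eq_zero fun i _ => ?_
      apply coeff_eq_zero_of_natDegree_lt
      refine lt_of_lt_of_le ?_ hn
      refine natDegree_mul_le.trans_lt ?_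
      rw [natDegree_X_pow]
      have h1 : (C (c (0, j, i)) * f ^ M + C ε * C (c (1, j, i))).natDegree
          ≤ f.natDegree * M := by
        rw [← C_mul, natDegree_add_C]
        refine (natDegree_C_mul_le _ _).trans ?_
        rw [natDegree_pow, mul_comm]
      have h2 : Q * i.1 ≤ Q * A := Nat.mul_le_mul_left _ i.2.le
      have := j.2
      omega
    ext n
    by_cases hn : n < N
    · exact congrFun (LinearMap.mem_ker.1 hcker) ⟨n, hn⟩
    · rw [coeff_zero]
      exact (degree_lt_iff_coeff_zero _ _).1 hdeg n (not_lt.1 hn)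
  let r : Fin 2 → ℕ → F[X] := fun b j => if hj : j < J then
    ∑ i : Fin A, C (c (b, ⟨j, hj⟩, i) ^ Q) * X ^ i.1 else 0
  have hrdeg : ∀ b j, (r b j).degree < A := by
    intro b j
    simp only [r]
    split_ifs with hj
    · rw [degree_lt_iff_coeff_zero]
      intro n hn
      rw [finsetSum_coeff]
      refine Finset.sum_eq_zero fun i _ => ?_
      rw [coeff_C_mul_X_pow, if_neg (by omega)]
    · simp
  set P := ∑ j ∈ Finset.range J, (r 0 j + r 1 j * f ^ M) * X ^ (j * Q) with hP
  have hP0 : P ≠ 0 := by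
    intro hP0
    have := stepanov_injective p s f h0 hns M A hM hA J (r 0) (r 1) (hrdeg 0) (hrdeg 1) hP0
    apply hc0
    have hz : ∀ b (j : Fin J) (i : Fin A), r b j.1 = 0 → c (b, j, i) = 0 := by
      intro b j i hb
      have h1 : (r b j.1).coeff i.1 = 0 := by rw [hb, coeff_zero]
      simp only [r, j.2, dif_pos, finsetSum_coeff, coeff_C_mul_X_pow] at h1
      simp only [← Fin.ext_iff] at h1
      rw [Finset.sum_eq_single i (fun a _ hai => if_neg (fun h => hai h.symm)) (by simp),
        if_pos rfl] at h1
      exact (pow_eq_zero_iff (by omega)).1 h1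
    ext ⟨b, j, i⟩
    fin_cases b
    · exact hz 0 j i (this j.1 j.2).1
    · exact hz 1 j i (this j.1 j.2).2
  have hcard : Z.card ≤ P.natDegree := by
    refine card_le_degree_of_subset_roots (Z := Z) fun x hx => ?_
    have hx : x ∈ Z := by simpa using hx
    rw [mem_roots hP0, IsRoot.def]
    have hfx : f.eval x ≠ 0 := by
      intro h
      have := hZ x hx
      rw [h, zero_pow (by positivity)] at this
      exact hε this.symm
    have hxq : ∀ y : F, (y ^ Q) ^ Q = y := by
      intro y
      rw [← pow_mul, ← sq, ← hF, FiniteField.pow_card]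
    have hev := congrArg (eval x) hEc
    rw [hE] at hev
    simp only [eval_finsetSum, eval_mul, eval_add, eval_C, eval_pow, eval_X, eval_zero] at hev
    have hPQ : (P.eval x) ^ Q * (f.eval x) ^ M = 0 := by
      rw [← hev, hP, eval_finsetSum, hQ, sum_pow_char_pow, ← hQ, Finset.sum_mul,
        Finset.sum_range]
      refine Finset.sum_congr rfl fun j _ => ?_
      simp only [eval_mul, eval_add, eval_pow, eval_X]
      rw [mul_pow, hQ, add_pow_char_pow, ← hQ]
      have hrQ : ∀ b, (eval x (r b j.1)) ^ Q = ∑ i : Fin A, c (b, j, i) * x ^ (Q * i.1) := by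
        intro b
        simp only [r, j.2, dif_pos, eval_finsetSum, eval_mul, eval_C, eval_pow, eval_X]
        rw [hQ, sum_pow_char_pow, ← hQ]
        refine Finset.sum_congr rfl fun i _ => ?_
        rw [mul_pow, hxq, ← pow_mul, mul_comm i.1]
      rw [mul_pow, hrQ, hrQ, mul_comm j.1 Q, pow_mul, ← pow_mul _ j.1, mul_comm j.1, pow_mul, hxq,
        Finset.sum_mul, ← Finset.sum_add_distrib, Finset.sum_mul, Finset.sum_mul]
      refine Finset.sum_congr rfl fun i _ => ?_
      rw [← hZ x hx, pow_add]
      ring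
    exact pow_eq_zero_iff (by omega) |>.1 ((mul_eq_zero.1 hPQ).resolve_right (pow_ne_zero _ hfx))
  refine hcard.trans ?_
  rw [hP]
  refine natDegree_sum_le_of_forall_le _ _ fun j hj => ?_
  have hj := Finset.mem_range.1 hj
  refine natDegree_mul_le.trans ?_
  rw [natDegree_X_pow]
  have h1 : ∀ b, (r b j).natDegree ≤ A := fun b =>
    natDegree_le_of_degree_le (hrdeg b j).le
  have h2 : (r 0 j + r 1 j * f ^ M).natDegree ≤ A + f.natDegree * M := by
    refine (natDegree_add_le _ _).trans (max_le ((h1 0).trans (by omega)) ?_)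
    refine natDegree_mul_le.trans (add_le_add (h1 1) ?_)
    rw [natDegree_pow, mul_comm]
  have h3 : j * Q ≤ Q * J := by rw [mul_comm]; exact Nat.mul_le_mul_left _ hj.le
  omega

theorem two_mul_card_le_of_eval_pow_eq {F : Type*} [Field F] [Fintype F] (p s : ℕ)
    [Fact p.Prime] [CharP F p] (f : F[X]) (h0 : f.eval 0 ≠ 0)
    (hns : ∀ (c : F) (h : F[X]), f ≠ C c * h ^ 2)
    (M : ℕ) (hM : p ^ s = 2 * M + 1) (hF : Fintype.card F = (p ^ s) ^ 2)
    (hd : 4 * f.natDegree + 7 ≤ p ^ s) (ε : F) (hε : ε ≠ 0)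
    (Z : Finset F) (hZ : ∀ x ∈ Z, f.eval x ^ (M * (p ^ s + 1)) = ε) :
    2 * Z.card ≤ (p ^ s) ^ 2 + p ^ s * (4 * f.natDegree + 8) := by
  set d := f.natDegree with hd'
  obtain ⟨A, rfl⟩ : ∃ A, M = A + d := ⟨M - d, by omega⟩
  -- With A = M - d and J = M + d + 3 the main term QJ is close to Q²/2, and the unknowns outnumber
  -- the conditions as soon as M ≥ 2d + 3.
  have := stepanov_card_le p s f h0 hns (A + d) A (A + d + d + 3) hM (by omega) hF
    (by omega) (by rw [hM, ← hd']; nlinarith) ε hε Z hZ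
  rw [← hd'] at this
  rw [hM] at this ⊢
  nlinarith

/-- The values 1 and -1 are each taken at most about half of the time, and 0 at most deg f times.
The three counts add up to Q², so an upper bound for one sign is a lower bound for the other. -/
theorem abs_sum_quadraticChar_eval_le {F : Type*} [Field F] [Fintype F] [DecidableEq F] (p s : ℕ)
    [Fact p.Prime] [CharP F p] (hp : p ≠ 2) (f : F[X])
    (hns : ∀ (c : F) (h : F[X]), f ≠ C c * h ^ 2) (hF : Fintype.card F = (p ^ s) ^ 2)
    (hd : 4 * f.natDegree + 7 ≤ p ^ s) :
    |∑ x : F, quadraticChar F (f.eval x)| ≤ (p : ℤ) ^ s * (5 * f.natDegree + 8) := by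
  have hf0 : f ≠ 0 := fun h => hns 0 0 (by simp [h])
  have hQq : p ^ s ≤ Fintype.card F := by
    rw [hF, sq]; exact Nat.le_mul_self _
  -- Translating the variable to a non-root of f changes neither the sum nor the hypotheses.
  wlog h0 : f.eval 0 ≠ 0 generalizing f
  · obtain ⟨a, ha⟩ : ∃ a, f.eval a ≠ 0 := by
      by_contra! hcon
      refine hf0 (eq_zero_of_natDegree_lt_card_of_eval_eq_zero' f Finset.univ (fun x _ => hcon x) ?_)
      rw [Finset.card_univ]; omega
    have hnd : (f.comp (X + C a)).natDegree = f.natDegree := by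
      rw [natDegree_comp, natDegree_X_add_C, mul_one]
    have hns' : ∀ (c : F) (h : F[X]), f.comp (X + C a) ≠ C c * h ^ 2 := by
      intro c h hch
      apply hns c (h.comp (X - C a))
      have := congrArg (fun g => g.comp (X - C a)) hch
      simpa [comp_assoc] using this
    have := this (f.comp (X + C a)) hns' (by rwa [hnd]) (fun h => hns' 0 0 (by simp [h]))
      (by simpa using ha)
    rw [hnd] at this
    convert this using 2
    rw [← Equiv.sum_comp (Equiv.addRight a)]
    simp
  have hF2 : ringChar F ≠ 2 := by rwa [ringChar.eq F p]
  obtain ⟨M, hM⟩ : ∃ M, p ^ s = 2 * M + 1 :=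
    (((Fact.out : p.Prime).eq_two_or_odd').resolve_left hp).pow
  have hhalf : Fintype.card F / 2 = M * (p ^ s + 1) := by
    rw [hF, hM]
    have : (2 * M + 1) ^ 2 = 2 * (M * (2 * M + 1 + 1)) + 1 := by ring
    omega
  have hcount : ∀ ε : ℤ, (ε = 1 ∨ ε = -1) →
      2 * ({x | quadraticChar F (f.eval x) = ε} : Finset F).card
        ≤ (p ^ s) ^ 2 + p ^ s * (4 * f.natDegree + 8) := by
    intro ε hε
    refine two_mul_card_le_of_eval_pow_eq p s f h0 hns M hM hF hd (ε : F) ?_ _ fun x hx => ?_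
    · rcases hε with rfl | rfl <;> simp
    · rw [Finset.mem_filter] at hx
      rw [← hx.2, quadraticChar_eq_pow_of_char_ne_two' hF2, hhalf]
  set N1 := ({x | quadraticChar F (f.eval x) = 1} : Finset F) with hN1
  set N2 := ({x | quadraticChar F (f.eval x) = -1} : Finset F) with hN2
  set N0 := ({x | f.eval x = 0} : Finset F) with hN0
  have hsum : ∑ x : F, quadraticChar F (f.eval x) = N1.card - N2.card := by
    rw [hN1, hN2, Finset.card_filter, Finset.card_filter]
    push_cast
    rw [← Finset.sum_sub_distrib]
    refine Finset.sum_congr rfl fun x _ => ?_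
    by_cases hx : f.eval x = 0
    · simp [hx]
    · rcases quadraticChar_dichotomy hx with h | h <;> simp [h]
  have htot : N1.card + N2.card + N0.card = (p ^ s) ^ 2 := by
    rw [← hF, ← Finset.card_univ, Finset.card_eq_sum_ones Finset.univ, hN1, hN2, hN0,
      Finset.card_filter, Finset.card_filter, Finset.card_filter, ← Finset.sum_add_distrib,
      ← Finset.sum_add_distrib]
    refine Finset.sum_congr rfl fun x _ => ?_
    by_cases hx : f.eval x = 0
    · simp [hx]
    · rcases quadraticChar_dichotomy hx with h | h <;> simp [h, hx]
  have hN0d : N0.card ≤ f.natDegree := by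
    refine card_le_degree_of_subset_roots fun x hx => ?_
    rw [mem_roots hf0]
    simpa [hN0] using hx
  have h1 := hcount 1 (Or.inl rfl)
  have h2 := hcount (-1) (Or.inr rfl)
  have hQ1 : 1 ≤ p ^ s := Nat.one_le_pow _ _ (Fact.out : p.Prime).pos
  rw [hsum, abs_le]
  zify at h1 h2 htot hN0d hQ1
  constructor <;> nlinarith

/-! ### Euler products over monic polynomials -/

section MonicPolynomials

variable (k : Type*) [Field k] [Finite k]

theorem finite_monic_natDegree_eq (m : ℕ) : {a : k[X] | a.Monic ∧ a.natDegree = m}.Finite := by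
  refine Set.Finite.of_finite_image
    (Set.toFinite ((fun (a : k[X]) (i : Fin m) => a.coeff i) '' _)) ?_
  intro a ha b hb hab
  obtain ⟨ha1, ha2⟩ := ha
  obtain ⟨hb1, hb2⟩ := hb
  ext n
  rcases lt_trichotomy n m with h | rfl | h
  · exact congrFun hab ⟨n, h⟩
  · have h1 := ha1.coeff_natDegree
    have h2 := hb1.coeff_natDegree
    rw [ha2] at h1
    rw [hb2] at h2
    rw [h1, h2]
  · rw [coeff_eq_zero_of_natDegree_lt (by omega), coeff_eq_zero_of_natDegree_lt (by omega)]

/-- The finite set of monic polynomials of degree `m` over a finite field. -/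
noncomputable def monicOfDegree (m : ℕ) : Finset k[X] := (finite_monic_natDegree_eq k m).toFinset

variable {k}

@[simp]
theorem mem_monicOfDegree {m : ℕ} {a : k[X]} :
    a ∈ monicOfDegree k m ↔ a.Monic ∧ a.natDegree = m := by
  simp [monicOfDegree]

variable (k) in
open Classical in
/-- The finite set of monic irreducible polynomials of degree `m` over a finite field. -/
noncomputable def irreducibleOfDegree (m : ℕ) : Finset k[X] :=
  {a ∈ monicOfDegree k m | Irreducible a}

@[simp]
theorem mem_irreducibleOfDegree {m : ℕ} {a : k[X]} :
    a ∈ irreducibleOfDegree k m ↔ (a.Monic ∧ a.natDegree = m) ∧ Irreducible a := by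
  simp [irreducibleOfDegree]

variable {R : Type*} [CommRing R] (ψ : k[X] →* R)

/-- The sum of a function over monic polynomials of degree `m`. -/
noncomputable def monicSum (m : ℕ) : R := ∑ a ∈ monicOfDegree k m, ψ a

/-- The coefficients of the logarithmic derivative of the Euler product of `ψ`. -/
noncomputable def eulerPowerSum (r : ℕ) : R :=
  ∑ x ∈ r.divisorsAntidiagonal, ∑ P ∈ irreducibleOfDegree k x.1, (x.1 : R) * ψ P ^ x.2

theorem monicSum_zero : monicSum ψ 0 = 1 := by
  have : monicOfDegree k 0 = {1} := by
    ext a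
    simp only [mem_monicOfDegree, Finset.mem_singleton]
    constructor
    · rintro ⟨h1, h2⟩
      exact h1.natDegree_eq_zero.1 h2
    · rintro rfl
      exact ⟨monic_one, natDegree_one⟩
  rw [monicSum, this, Finset.sum_singleton, map_one]

-- This is the von Mangoldt identity: an irreducible P contributes its degree once for each power
-- P^e dividing a. Exponents up to deg a suffice, since no multiplicity exceeds the degree.
open Classical in
theorem natDegree_eq_sum_pow_dvd {a : k[X]} (ha : a.Monic) :
    a.natDegree = ∑ d ∈ Finset.Icc 1 a.natDegree, ∑ P ∈ irreducibleOfDegree k d,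
      ∑ e ∈ Finset.Icc 1 a.natDegree, if P ^ e ∣ a then d else 0 := by
  set m := a.natDegree with hm
  set s := UniqueFactorizationMonoid.normalizedFactors a with hs
  have hsm : ∀ P ∈ s, P.Monic ∧ Irreducible P := by
    intro P hP
    have hirr := UniqueFactorizationMonoid.irreducible_of_normalized_factor P hP
    exact ⟨(normalize_eq_self_iff_monic hirr.ne_zero).1
      (UniqueFactorizationMonoid.normalize_normalized_factor P hP), hirr⟩
  have hprod : s.prod = a := by
    refine eq_of_monic_of_associated ?_ ha (UniqueFactorizationMonoid.prod_normalizedFactors ha.ne_zero)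
    simpa using monic_multiset_prod_of_monic s id (fun P hP => (hsm P hP).1)
  have hcount : ∀ P : k[X], P.Monic → Irreducible P →
      (∑ e ∈ Finset.Icc 1 m, if P ^ e ∣ a then P.natDegree else 0) = s.count P * P.natDegree := by
    intro P hP hirr
    have hdvd : ∀ e, P ^ e ∣ a ↔ e ≤ s.count P := by
      intro e
      rw [pow_dvd_iff_le_emultiplicity,
        UniqueFactorizationMonoid.emultiplicity_eq_count_normalizedFactors hirr ha.ne_zero,
        hP.normalize_eq_self, Nat.cast_le]
    have hle : s.count P ≤ m := by
      have h1 := natDegree_le_of_dvd ((hdvd _).2 le_rfl) ha.ne_zero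
      rw [natDegree_pow] at h1
      exact (Nat.le_mul_of_pos_right _ hirr.natDegree_pos).trans h1
    simp_rw [hdvd]
    rw [← Finset.sum_filter, Finset.sum_const, smul_eq_mul]
    congr 1
    have : (Finset.Icc 1 m).filter (fun e => e ≤ s.count P) = Finset.Icc 1 (s.count P) := by
      ext e
      simp only [Finset.mem_filter, Finset.mem_Icc]
      omega
    rw [this, Nat.card_Icc, Nat.add_sub_cancel]
  have hmem : ∀ P ∈ s, P.natDegree ∈ Finset.Icc 1 m ∧ P ∈ irreducibleOfDegree k P.natDegree := by
    intro P hP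
    obtain ⟨h1, h2⟩ := hsm P hP
    refine ⟨Finset.mem_Icc.2 ⟨h2.natDegree_pos, natDegree_le_of_dvd ?_ ha.ne_zero⟩, ?_⟩
    · exact UniqueFactorizationMonoid.dvd_of_mem_normalizedFactors hP
    · simp [h1, h2]
  have hdeg : m = ∑ P ∈ s.toFinset, s.count P * P.natDegree := by
    rw [hm, ← hprod]
    have := natDegree_multiset_prod_of_monic s (fun P hP => (hsm P hP).1)
    rw [this, Finset.sum_multiset_map_count]
    simp
  conv_lhs => rw [hdeg]
  rw [Finset.sum_sigma']
  symm
  refine (Finset.sum_subset_zero_on_sdiff (s₁ := s.toFinset.map ⟨fun P : k[X] =>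
    (⟨P.natDegree, P⟩ : (_ : ℕ) × k[X]), fun P P' h => by simpa using (Sigma.mk.inj h).2⟩)
    ?_ ?_ (fun _ _ => rfl)).symm.trans ?_
  · intro x hx
    simp only [Finset.mem_map, Multiset.mem_toFinset] at hx
    obtain ⟨P, hP, rfl⟩ := hx
    exact Finset.mem_sigma.2 (hmem P hP)
  · rintro ⟨d, P⟩ hx
    simp only [Finset.mem_sdiff, Finset.mem_sigma, mem_irreducibleOfDegree, Finset.mem_map,
      Multiset.mem_toFinset] at hx
    obtain ⟨⟨-, ⟨h1, rfl⟩, h2⟩, h3⟩ := hx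
    rw [hcount P h1 h2, Multiset.count_eq_zero_of_notMem, zero_mul]
    intro hP
    exact h3 ⟨P, hP, rfl⟩
  · rw [Finset.sum_map]
    refine Finset.sum_congr rfl fun P hP => ?_
    obtain ⟨h1, h2⟩ := hsm P (Multiset.mem_toFinset.1 hP)
    exact hcount P h1 h2

open Classical in
theorem sum_monicOfDegree_pow_dvd (m e d : ℕ) {P : k[X]} (hP : P.Monic) (hd : P.natDegree = d) :
    ∑ a ∈ monicOfDegree k m, (if P ^ e ∣ a then ψ a else 0) =
      if e * d ≤ m then ψ P ^ e * monicSum ψ (m - e * d) else 0 := by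
  have hPe : (P ^ e).natDegree = e * d := by rw [natDegree_pow, hd]
  rw [← Finset.sum_filter]
  split_ifs with h
  · rw [monicSum, Finset.mul_sum]
    symm
    refine Finset.sum_bij (fun b _ => P ^ e * b) ?_ ?_ ?_ ?_
    · intro b hb
      rw [mem_monicOfDegree] at hb
      refine Finset.mem_filter.2 ⟨mem_monicOfDegree.2 ⟨(hP.pow e).mul hb.1, ?_⟩, dvd_mul_right _ _⟩
      rw [(hP.pow e).natDegree_mul hb.1, hPe, hb.2]
      omega
    · intro b _ b' _ hbb
      exact mul_left_cancel₀ (hP.pow e).ne_zero hbb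
    · intro a ha
      obtain ⟨ha, b, rfl⟩ := Finset.mem_filter.1 ha
      rw [mem_monicOfDegree] at ha
      have hb := (hP.pow e).of_mul_monic_left ha.1
      refine ⟨b, mem_monicOfDegree.2 ⟨hb, ?_⟩, rfl⟩
      have := ha.2
      rw [(hP.pow e).natDegree_mul hb, hPe] at this
      omega
    · intro b _
      rw [map_mul, map_pow]
  · refine Finset.sum_eq_zero fun a ha => ?_
    obtain ⟨ha, hdvd⟩ := Finset.mem_filter.1 ha
    rw [mem_monicOfDegree] at ha
    have := natDegree_le_of_dvd hdvd ha.1.ne_zero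
    omega

/-- Coefficient form of u L'(u) = L(u) Σ S_r u^r, where L has coefficients `monicSum` and S is
`eulerPowerSum`. Weighting each a by its degree, expanded over the P^e dividing a, and factoring P^e
out of a replaces any manipulation of infinite products. -/
theorem mul_monicSum (m : ℕ) :
    (m : R) * monicSum ψ m = ∑ r ∈ Finset.Icc 1 m, eulerPowerSum ψ r * monicSum ψ (m - r) := by
  classical
  have h1 : (m : R) * monicSum ψ m = ∑ d ∈ Finset.Icc 1 m, ∑ e ∈ Finset.Icc 1 m,
      if e * d ≤ m then (∑ P ∈ irreducibleOfDegree k d, (d : R) * ψ P ^ e) *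
        monicSum ψ (m - e * d) else 0 := by
    have : ∀ a ∈ monicOfDegree k m, (m : R) * ψ a =
        ∑ d ∈ Finset.Icc 1 m, ∑ P ∈ irreducibleOfDegree k d, ∑ e ∈ Finset.Icc 1 m,
          (d : R) * if P ^ e ∣ a then ψ a else 0 := by
      intro a ha
      rw [mem_monicOfDegree] at ha
      have h := natDegree_eq_sum_pow_dvd ha.1
      rw [ha.2] at h
      conv_lhs => rw [h]
      push_cast
      simp only [Finset.sum_mul]
      refine Finset.sum_congr rfl fun d _ => Finset.sum_congr rfl fun P _ =>
        Finset.sum_congr rfl fun e _ => ?_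
      split_ifs <;> simp
    rw [monicSum, Finset.mul_sum, Finset.sum_congr rfl this, Finset.sum_comm]
    refine Finset.sum_congr rfl fun d _ => ?_
    rw [Finset.sum_comm]
    simp_rw [Finset.sum_comm (s := monicOfDegree k m)]
    rw [Finset.sum_comm]
    refine Finset.sum_congr rfl fun e _ => ?_
    rw [Finset.sum_mul]
    split_ifs with h
    · refine Finset.sum_congr rfl fun P hP => ?_
      rw [mem_irreducibleOfDegree] at hP
      rw [← Finset.mul_sum, sum_monicOfDegree_pow_dvd ψ m e d hP.1.1 hP.1.2, if_pos h]
      ring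
    · refine Finset.sum_eq_zero fun P hP => ?_
      rw [mem_irreducibleOfDegree] at hP
      rw [← Finset.mul_sum, sum_monicOfDegree_pow_dvd ψ m e d hP.1.1 hP.1.2, if_neg h, mul_zero]
  rw [h1]
  simp_rw [eulerPowerSum, Finset.sum_mul]
  rw [Finset.sum_sigma', Finset.sum_sigma', ← Finset.sum_filter]
  refine Finset.sum_bij' (fun x _ => (⟨x.1 * x.2, (x.1, x.2)⟩ : (_ : ℕ) × (ℕ × ℕ)))
    (fun y _ => (⟨y.2.1, y.2.2⟩ : (_ : ℕ) × ℕ)) ?_ ?_ ?_ ?_ ?_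
  · rintro ⟨d, e⟩ hx
    simp only [Finset.mem_filter, Finset.mem_sigma, Finset.mem_Icc] at hx
    simp only [Finset.mem_sigma, Finset.mem_Icc, Nat.mem_divisorsAntidiagonal, true_and]
    have : 0 < d * e := by apply Nat.mul_pos <;> omega
    have h3 := hx.2
    rw [mul_comm] at h3
    omega
  · rintro ⟨r, d, e⟩ hy
    simp only [Finset.mem_sigma, Finset.mem_Icc, Nat.mem_divisorsAntidiagonal] at hy
    obtain ⟨⟨h1, h2⟩, rfl, h3⟩ := hy
    have hd : 0 < d := Nat.pos_of_ne_zero (left_ne_zero_of_mul h3)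
    have he : 0 < e := Nat.pos_of_ne_zero (right_ne_zero_of_mul h3)
    simp only [Finset.mem_filter, Finset.mem_sigma, Finset.mem_Icc]
    have := Nat.le_mul_of_pos_right d he
    have := Nat.le_mul_of_pos_left e hd
    rw [mul_comm e d]
    omega
  · rintro ⟨d, e⟩ _
    rfl
  · rintro ⟨r, d, e⟩ hy
    simp only [Finset.mem_sigma, Nat.mem_divisorsAntidiagonal] at hy
    obtain ⟨_, rfl, _⟩ := hy
    rfl
  · rintro ⟨d, e⟩ _
    simp only [mul_comm e d]

end MonicPolynomials

/-! ### Power sums of complex numbers -/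

/-- Write L(u) = Σ c_m u^m = ∏ (1 - ω_i u). Newton's identities show that -Σ ω_i^r satisfies the
recursion assumed for S, and c₀ = 1 makes its solution unique. The ω_i are the roots of the reversed
polynomial, so some vanish if L has degree below d - 1. -/
theorem exists_power_sums_of_newton (d : ℕ) (hd : 1 ≤ d) (c S : ℕ → ℂ) (hc0 : c 0 = 1)
    (hcd : ∀ m, d ≤ m → c m = 0)
    (hN : ∀ m : ℕ, (m : ℂ) * c m = ∑ r ∈ Finset.Icc 1 m, S r * c (m - r)) :
    ∃ ω : Fin (d - 1) → ℂ,
      (∀ z, ∑ m ∈ Finset.range d, c m * z ^ (d - 1 - m) = ∏ i, (z - ω i)) ∧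
      ∀ r, 1 ≤ r → S r = - ∑ i, ω i ^ r := by
  set n := d - 1 with hn
  have hdn : d = n + 1 := by omega
  set P : ℂ[X] := ∑ m ∈ Finset.range d, C (c m) * X ^ (n - m) with hP
  have hcoeff : ∀ m ≤ n, P.coeff (n - m) = c m := by
    intro m hm
    rw [hP, finsetSum_coeff, Finset.sum_eq_single m]
    · rw [coeff_C_mul_X_pow, if_pos rfl]
    · intro b hb hbm
      rw [Finset.mem_range] at hb
      rw [coeff_C_mul_X_pow, if_neg (by omega)]
    · intro h
      exact absurd (Finset.mem_range.2 (by omega)) h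
  have hdegle : P.natDegree ≤ n := by
    refine natDegree_sum_le_of_forall_le _ _ fun m _ => ?_
    exact (natDegree_C_mul_X_pow_le _ _).trans (Nat.sub_le _ _)
  have hcn : P.coeff n = 1 := by
    have := hcoeff 0 (Nat.zero_le _)
    rwa [Nat.sub_zero, hc0] at this
  have hdeg : P.natDegree = n := natDegree_eq_of_le_of_coeff_ne_zero hdegle (by rw [hcn]; simp)
  have hmonic : P.Monic := by rw [Monic, leadingCoeff, hdeg, hcn]
  have hcard : P.roots.card = P.natDegree :=
    (splits_iff_card_roots.1 (IsAlgClosed.splits P))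
  have hlen : P.roots.toList.length = n := by rw [Multiset.length_toList, hcard, hdeg]
  let ω : Fin n → ℂ := fun i => P.roots.toList.get (i.cast hlen.symm)
  have hω : Finset.univ.val.map ω = P.roots := by
    have h1 : List.ofFn ω = P.roots.toList := by
      conv_rhs => rw [← List.ofFn_get P.roots.toList]
      exact (List.ofFn_congr hlen _).symm
    rw [← P.roots.coe_toList, ← h1, Fin.univ_val_map]
  refine ⟨ω, ?_, ?_⟩
  · intro z
    have h1 : P.eval z = ∑ m ∈ Finset.range d, c m * z ^ (n - m) := by
      rw [hP, eval_finsetSum]; simp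
    rw [← h1, ← prod_multiset_X_sub_C_of_monic_of_roots_card_eq hmonic hcard, ← hω,
      Multiset.map_map, eval_multiset_prod, Multiset.map_map, Finset.prod_eq_multiset_prod]
    simp
  · have hesymm : ∀ m, c m = (-1) ^ m * MvPolynomial.aeval ω (MvPolynomial.esymm (Fin n) ℂ m) := by
      intro m
      rw [MvPolynomial.aeval_esymm_eq_multiset_esymm, hω]
      by_cases hm : m ≤ n
      · rw [← hcoeff m hm, coeff_eq_esymm_roots_of_card hcard (by omega), hmonic.leadingCoeff, hdeg,
          Nat.sub_sub_self hm, one_mul]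
      · rw [hcd m (by omega), Multiset.esymm, Multiset.powersetCard_eq_empty _ (by omega)]
        simp
    have hnewton : ∀ m : ℕ, (m : ℂ) * c m = - ∑ r ∈ Finset.Icc 1 m, (∑ i, ω i ^ r) * c (m - r) := by
      intro m
      have h := congrArg (MvPolynomial.aeval ω) (MvPolynomial.mul_esymm_eq_sum (Fin n) ℂ m)
      simp only [map_mul, map_natCast, map_pow, map_neg, map_one, map_sum, MvPolynomial.psum,
        MvPolynomial.aeval_X] at h
      rw [hesymm m, mul_left_comm, h, ← mul_assoc, ← pow_add,
        (by omega : m + (m + 1) = 2 * m + 1), pow_succ, pow_mul]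
      simp only [even_two, Even.neg_pow, one_pow, one_mul, neg_mul, neg_inj]
      refine Finset.sum_bij' (fun a _ => a.2) (fun r _ => (m - r, r)) ?_ ?_ ?_ ?_ ?_
      · rintro ⟨a, b⟩ hab
        simp only [Finset.mem_filter, Finset.HasAntidiagonal.mem_antidiagonal, Finset.mem_Icc] at hab ⊢
        omega
      · intro r hr
        simp only [Finset.mem_filter, Finset.HasAntidiagonal.mem_antidiagonal, Finset.mem_Icc] at hr ⊢
        omega
      · rintro ⟨a, b⟩ hab
        simp only [Finset.mem_filter, Finset.HasAntidiagonal.mem_antidiagonal, Prod.mk.injEq, and_true] at hab ⊢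
        omega
      · intro r _
        rfl
      · rintro ⟨a, b⟩ hab
        simp only [Finset.mem_filter, Finset.HasAntidiagonal.mem_antidiagonal] at hab ⊢
        rw [(by omega : m - b = a), hesymm a]
        ring
    intro r
    induction r using Nat.strong_induction_on with
    | _ r ih =>
      intro hr
      have h1 := hN r
      rw [hnewton r] at h1
      have hI : Finset.Icc 1 r = insert r (Finset.Icc 1 (r - 1)) := by
        ext x; simp only [Finset.mem_insert, Finset.mem_Icc]; omega
      have hr' : r ∉ Finset.Icc 1 (r - 1) := by rw [Finset.mem_Icc]; omega
      rw [hI, Finset.sum_insert hr', Finset.sum_insert hr', Nat.sub_self, hc0] at h1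
      have h2 : ∑ x ∈ Finset.Icc 1 (r - 1), S x * c (r - x) =
          - ∑ x ∈ Finset.Icc 1 (r - 1), (∑ i, ω i ^ x) * c (r - x) := by
        rw [← Finset.sum_neg_distrib]
        refine Finset.sum_congr rfl fun x hx => ?_
        rw [Finset.mem_Icc] at hx
        rw [ih x (by omega) hx.1, neg_mul]
      rw [h2] at h1
      linear_combination -h1

-- By recurrence on a compact torus, arbitrarily large m bring the phases of all ω_j^m close to 1
-- simultaneously. For such m there is no cancellation and |ω_i|^m / 2 ≤ D B^m, which excludes |ω_i|
-- > B whatever D is.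
open Filter Topology in
theorem norm_le_of_norm_sum_pow_le {n : ℕ} (ω : Fin n → ℂ) (B D : ℝ) (hB : 0 < B) (m₀ : ℕ)
    (h : ∀ m, m₀ ≤ m → ‖∑ i, ω i ^ m‖ ≤ D * B ^ m) (i : Fin n) : ‖ω i‖ ≤ B := by
  by_contra! hi
  have hex : ∀ z : ℂ, ∃ u : Circle, z = ‖z‖ * u := fun z =>
    ⟨Circle.exp z.arg, by rw [Circle.coe_exp, Complex.norm_mul_exp_arg_mul_I]⟩
  choose u hu using hex
  let v : Fin n → Circle := fun i => u (ω i)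
  have hcl := mapClusterPt_one_atTop_pow v
  have hU : {w : Fin n → Circle | ∀ i, (1 / 2 : ℝ) < ((w i : ℂ)).re} ∈ 𝓝 (1 : Fin n → Circle) := by
    apply IsOpen.mem_nhds
    · simp only [Set.ofPred_forall]
      refine isOpen_iInter_of_finite fun i => ?_
      refine isOpen_lt continuous_const ?_
      fun_prop
    · intro i
      norm_num
  have hfreq : ∃ᶠ m in atTop, v ^ m ∈ {w : Fin n → Circle | ∀ i, (1 / 2 : ℝ) < ((w i : ℂ)).re} :=
    (mapClusterPt_iff_frequently.1 hcl) _ hU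
  have hpow : ∀ m, m₀ ≤ m → v ^ m ∈ {w : Fin n → Circle | ∀ i, (1 / 2 : ℝ) < ((w i : ℂ)).re} →
      (‖ω i‖ / B) ^ m ≤ 2 * D := by
    intro m hm hv
    have h1 : ∀ j, ‖ω j‖ ^ m / 2 ≤ (ω j ^ m).re := by
      intro j
      have h2 : (ω j ^ m) = ((‖ω j‖ ^ m : ℝ) : ℂ) * (((v ^ m) j : Circle) : ℂ) := by
        conv_lhs => rw [hu (ω j)]
        rw [mul_pow]
        simp [v]
      rw [h2, Complex.re_ofReal_mul]
      have := hv j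
      have h0 : 0 ≤ ‖ω j‖ ^ m := by positivity
      nlinarith
    have h3 : ‖ω i‖ ^ m / 2 ≤ D * B ^ m := by
      refine le_trans ?_ ((Complex.re_le_norm _).trans (h m hm))
      rw [Complex.re_sum]
      refine (h1 i).trans (Finset.single_le_sum (f := fun j => (ω j ^ m).re) (fun j _ => ?_) (Finset.mem_univ i))
      exact le_trans (by positivity) (h1 j)
    rw [div_pow, div_le_iff₀ (by positivity)]
    linarith
  have htend : Tendsto (fun m : ℕ => (‖ω i‖ / B) ^ m) atTop atTop :=
    tendsto_pow_atTop_atTop_of_one_lt ((one_lt_div hB).2 hi)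
  obtain ⟨m, hm, hm1, hm2⟩ := (hfreq.and_eventually
    ((eventually_ge_atTop m₀).and (htend.eventually_gt_atTop (2 * D)))).exists
  exact absurd (hpow m hm1 hm) (not_le.2 hm2)

/-! ### Resultants and norms -/

/-- The norm is det g(A), with A the multiplication matrix of the generator. Factoring g over the
algebraic closure turns it into a product of values, at the roots of g, of the characteristic
polynomial of A, which is the minimal polynomial. -/
theorem norm_aeval_gen_eq_resultant {k S : Type*} [Field k] [CommRing S] [Algebra k S]
    (pb : PowerBasis k S) (g : k[X]) :
    Algebra.norm k (aeval pb.gen g) = resultant (minpoly k pb.gen) g := by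
  classical
  let E := AlgebraicClosure k
  have : Module.Finite k S := pb.finite
  by_cases hg : g = 0
  · subst hg
    by_cases hdim : (minpoly k pb.gen).natDegree = 0
    · rw [pb.natDegree_minpoly] at hdim
      have h0 := pb.finrank
      rw [hdim] at h0
      have := Module.finrank_zero_iff.1 h0
      rw [Subsingleton.elim (aeval pb.gen (0 : k[X])) 1, map_one]
      have h1 : minpoly k pb.gen = 1 :=
        (minpoly.monic pb.isIntegral_gen).natDegree_eq_zero.1 (by rw [pb.natDegree_minpoly, hdim])
      rw [h1]; simp
    · have : Nontrivial S := by
        by_contra hS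
        rw [not_nontrivial_iff_subsingleton] at hS
        have := minpoly.subsingleton k pb.gen
        rw [this] at hdim
        simp at hdim
      rw [map_zero, Algebra.norm_zero]
      rw [resultant_zero_right, zero_pow hdim, zero_mul]
  apply (algebraMap k E).injective
  set P := minpoly k pb.gen with hP
  have hPmon : P.Monic := minpoly.monic pb.isIntegral_gen
  set A := Algebra.leftMulMatrix pb.basis pb.gen with hA
  have hchar : A.charpoly = P := charpoly_leftMulMatrix pb
  have h1 : Algebra.norm k (aeval pb.gen g) = (aeval A g).det := by
    rw [Algebra.norm_eq_matrix_det pb.basis, hA, aeval_algHom_apply]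
  have h2 : algebraMap k E (aeval A g).det =
      (aeval (A.map (algebraMap k E)) (g.map (algebraMap k E))).det := by
    rw [RingHom.map_det]
    congr 1
    rw [aeval_map_algebraMap]
    exact ((aeval_algHom_apply (Algebra.ofId k E).mapMatrix A g)).symm
  have hsplit := IsAlgClosed.splits (g.map (algebraMap k E))
  rw [h1, h2, hsplit.eq_prod_roots]
  have h3 : (aeval (A.map (algebraMap k E))) (((g.map (algebraMap k E)).roots.map
      (fun a => X - C a)).prod) = ((g.map (algebraMap k E)).roots.toList.map
        (fun a => A.map (algebraMap k E) - Matrix.scalar _ a)).prod := by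
    conv_lhs => rw [← (g.map (algebraMap k E)).roots.coe_toList]
    rw [Multiset.map_coe, Multiset.prod_coe, map_list_prod, List.map_map]
    congr 1
    refine List.map_congr_left fun a _ => ?_
    simp [Algebra.algebraMap_eq_smul_one, Matrix.smul_one_eq_diagonal]
  have h4 : ∀ a, (A.map (algebraMap k E) - Matrix.scalar _ a).det =
      (-1) ^ P.natDegree * eval a (P.map (algebraMap k E)) := by
    intro a
    rw [← hchar, ← Matrix.charpoly_map, Matrix.eval_charpoly, ← neg_sub, Matrix.det_neg,
      Matrix.charpoly_natDegree_eq_dim]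
  rw [map_mul, h3, aeval_C, Matrix.det_mul, ← Matrix.coe_detMonoidHom, map_list_prod, List.map_map]
  have h5 : ((g.map (algebraMap k E)).roots.toList.map
      (Matrix.detMonoidHom ∘ fun a => A.map (algebraMap k E) - Matrix.scalar _ a)).prod =
      (-1) ^ (P.natDegree * g.natDegree) *
        ((g.map (algebraMap k E)).roots.map (eval · (P.map (algebraMap k E)))).prod := by
    rw [pow_mul, ← natDegree_map (p := g) (algebraMap k E), hsplit.natDegree_eq_card_roots,
      ← Multiset.prod_replicate, ← Multiset.map_const', ← Multiset.prod_map_mul]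
    conv_rhs => rw [← (g.map (algebraMap k E)).roots.coe_toList]
    rw [Multiset.map_coe, Multiset.prod_coe]
    congr 1
    exact List.map_congr_left fun a _ => h4 a
  rw [h5, ← resultant_map_map, resultant_comm, ← natDegree_map (p := g) (algebraMap k E),
    resultant_eq_prod_eval _ _ _ (natDegree_map_le) hsplit, natDegree_map]
  have h6 : Matrix.detMonoidHom (algebraMap E (Matrix (Fin pb.dim) (Fin pb.dim) E)
      (g.map (algebraMap k E)).leadingCoeff) = (g.map (algebraMap k E)).leadingCoeff ^ P.natDegree := by
    rw [Matrix.coe_detMonoidHom, Matrix.algebraMap_eq_diagonal, Matrix.det_diagonal]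
    simp [hP, pb.natDegree_minpoly]
  rw [h6]
  ring

theorem resultant_eq_of_dvd_sub {k : Type*} [Field k] {U a b : k[X]} (hU : U.Monic)
    (h : U ∣ a - b) : resultant U a = resultant U b := by
  apply (algebraMap k (AlgebraicClosure k)).injective
  set φ := algebraMap k (AlgebraicClosure k)
  have key : ∀ a : k[X], φ (resultant U a) = ((U.map φ).roots.map (eval · (a.map φ))).prod := by
    intro a
    rw [← resultant_map_map, ← natDegree_map (p := U) φ,
      resultant_eq_prod_eval _ _ _ natDegree_map_le (IsAlgClosed.splits _),
      (hU.map φ).leadingCoeff, one_pow, one_mul]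
  rw [key, key]
  congr 1
  refine Multiset.map_congr rfl fun θ hθ => ?_
  obtain ⟨w, hw⟩ := h
  have h0 : eval θ (U.map φ) = 0 := (mem_roots'.1 hθ).2
  have : a = b + U * w := by rw [← hw]; ring
  rw [this]
  simp [h0]

/-- The exponent is [L : k(x)], coming from the norm of L over k(x) of an element of k(x). -/
theorem norm_aeval_eq_resultant_pow {k L : Type*} [Field k] [Field L] [Algebra k L]
    [FiniteDimensional k L] (x : L) (g : k[X]) :
    Algebra.norm k (aeval x g) =
      resultant (minpoly k x) g ^ (Module.finrank k L / (minpoly k x).natDegree) := by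
  have hx : IsIntegral k x := Algebra.IsIntegral.isIntegral x
  let pb := IntermediateField.adjoin.powerBasis hx
  have hgen : pb.gen = IntermediateField.AdjoinSimple.gen k x := rfl
  have h1 : aeval x g = algebraMap (IntermediateField.adjoin k {x}) L (aeval pb.gen g) := by
    rw [← aeval_algebraMap_apply, hgen, IntermediateField.AdjoinSimple.algebraMap_gen]
  have hmin : minpoly k pb.gen = minpoly k x := by
    rw [hgen, IntermediateField.minpoly_gen]
  rw [h1, ← Algebra.norm_norm (S := IntermediateField.adjoin k {x}), Algebra.norm_algebraMap, map_pow,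
    norm_aeval_gen_eq_resultant, hmin]
  congr 1
  have h2 := Module.finrank_mul_finrank k (IntermediateField.adjoin k {x}) L
  rw [IntermediateField.adjoin.finrank hx] at h2
  rw [← h2, Nat.mul_div_cancel_left _ (minpoly.natDegree_pos hx)]

/-- Norms from k[X]/(P) are surjective for an irreducible factor P of U. Squarefreeness makes P
coprime to its cofactor V, so b can have the required class modulo P and be 1 modulo V. -/
theorem exists_resultant_eq {k : Type*} [Field k] [Finite k] {U : k[X]} (hU : U.Monic)
    (hsq : Squarefree U) (hd : 0 < U.natDegree) (c : k) :
    ∃ b, resultant U b = c := by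
  obtain ⟨P, hPm, hPi, V, hV⟩ := exists_monic_irreducible_factor U
    (fun h => by rw [natDegree_eq_zero_of_isUnit h] at hd; exact hd.ne rfl)
  have : Fact (Irreducible P) := ⟨hPi⟩
  have : Module.Finite k (AdjoinRoot P) := (AdjoinRoot.powerBasis hPi.ne_zero).finite
  have : Finite (AdjoinRoot P) := Module.finite_of_finite k
  obtain ⟨y, hy⟩ := FiniteField.norm_surjective k (AdjoinRoot P) c
  obtain ⟨β, rfl⟩ := AdjoinRoot.mk_surjective y
  have h1 : resultant P β = c := by
    rw [← hy, ← AdjoinRoot.aeval_eq, ← AdjoinRoot.powerBasis_gen hPi.ne_zero,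
      norm_aeval_gen_eq_resultant, AdjoinRoot.powerBasis_gen, AdjoinRoot.minpoly_root hPi.ne_zero,
      hPm.leadingCoeff, inv_one, C_1, mul_one]
  have hVm : V.Monic := hPm.of_mul_monic_left (hV ▸ hU)
  have hcop : IsCoprime P V := by
    refine (hPi.coprime_iff_not_dvd).2 fun ⟨W, hW⟩ => ?_
    exact hPi.not_isUnit (hsq P ⟨W, by rw [hV, hW]; ring⟩)
  obtain ⟨s, t, hst⟩ := hcop
  refine ⟨β * (t * V) + s * P, ?_⟩
  have h2 := resultant_mul_left P V (β * (t * V) + s * P) _ le_rfl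
  rw [← hPm.natDegree_mul hVm, ← hV] at h2
  rw [h2, resultant_eq_of_dvd_sub hPm (b := β), h1, resultant_eq_of_dvd_sub hVm (b := 1)]
  · simp
  · exact ⟨β * t - t, by linear_combination hst⟩
  · exact ⟨s - β * s, by linear_combination β * hst⟩

theorem resultant_eq_mul_of_dvd_sub {k : Type*} [Field k] {U a b e : k[X]} (hU : U.Monic) (ha : a ≠ 0) (hb : b ≠ 0)
    (h : U ∣ e - a * b) : resultant U e = resultant U a * resultant U b := by
  rw [resultant_eq_of_dvd_sub hU h, natDegree_mul ha hb, resultant_mul_right _ _ _ _ le_rfl]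

theorem sum_eq_zero_of_injOn_neg {α : Type*} [DecidableEq α] (s : Finset α) (φ : α → ℤ) (σ : α → α)
    (hσ : ∀ a ∈ s, σ a ∈ s) (hinj : Set.InjOn σ s) (hφ : ∀ a ∈ s, φ (σ a) = - φ a) :
    ∑ a ∈ s, φ a = 0 := by
  have h1 : s.image σ = s := by
    apply Finset.eq_of_subset_of_card_le
    · intro x hx
      obtain ⟨a, ha, rfl⟩ := Finset.mem_image.1 hx
      exact hσ a ha
    · rw [Finset.card_image_of_injOn hinj]
  have h2 : ∑ a ∈ s, φ a = ∑ a ∈ s, φ (σ a) := by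
    conv_lhs => rw [← h1]
    exact Finset.sum_image hinj
  rw [Finset.sum_congr rfl hφ, Finset.sum_neg_distrib] at h2
  omega

/-! ### The quadratic character of a resultant and its L-function -/

section ResultantChar

variable {k : Type*} [Field k] [Fintype k] [DecidableEq k]

open Classical in
/-- The completely multiplicative function `a ↦ χ(Res(a, U))` on polynomials over a finite field,
where `χ` is the quadratic character. -/
noncomputable def resultantChar (U : k[X]) : k[X] →* ℤ where
  -- Zero is separated because multiplicativity of the resultant rests on the additivity of degrees.
  toFun a := if a = 0 then 0 else quadraticChar k (resultant a U)
  map_one' := by simp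
  map_mul' a b := by
    by_cases ha : a = 0
    · simp [ha]
    by_cases hb : b = 0
    · simp [hb]
    rw [if_neg ha, if_neg hb, if_neg (mul_ne_zero ha hb), natDegree_mul ha hb,
      resultant_mul_left _ _ _ _ le_rfl, map_mul]

theorem resultantChar_of_monic (U : k[X]) {a : k[X]} (ha : a.Monic) :
    resultantChar U a = quadraticChar k (resultant a U) := if_neg ha.ne_zero

/-- Reciprocity: up to a factor depending only on deg a, the character becomes a function of a
modulo U. -/
theorem resultantChar_eq_mul {c : k} (U : k[X]) (hc : c ≠ 0) {a : k[X]}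
    (ha : a.Monic) : resultantChar (C c * U) a =
      quadraticChar k ((-1) ^ U.natDegree * c) ^ a.natDegree * quadraticChar k (resultant U a) := by
  rw [resultantChar_of_monic _ ha, ← map_pow, ← map_mul]
  congr 1
  rw [natDegree_C_mul hc, resultant_C_mul_right, resultant_comm, mul_pow, ← pow_mul, mul_comm a.natDegree]
  ring

theorem exists_isCoprime_quadraticChar_resultant_eq_neg_one (hk : ringChar k ≠ 2) {U : k[X]}
    (hU : U.Monic) (hsq : Squarefree U) (hd : 0 < U.natDegree) :
    ∃ b, b ≠ 0 ∧ IsCoprime U b ∧ quadraticChar k (resultant U b) = -1 := by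
  obtain ⟨ν, hν⟩ := quadraticChar_exists_neg_one hk
  obtain ⟨b, rfl⟩ := exists_resultant_eq hU hsq hd ν
  have h0 : resultant U b ≠ 0 := by
    intro h
    rw [h, quadraticChar_zero] at hν
    norm_num at hν
  have hcop : IsCoprime U b := by
    by_contra hcon
    exact h0 (resultant_eq_zero_iff.2 ⟨Or.inl hU.ne_zero, hcon⟩)
  refine ⟨b, ?_, hcop, hν⟩
  rintro rfl
  rw [resultant_zero_right, zero_pow hd.ne', zero_mul] at h0
  exact h0 rfl

/-- This makes the L-function a polynomial. Once m ≥ deg U, changing a by a remainder modulo U keeps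
it monic of degree m, so its class can be multiplied by a b of character -1. The resulting injection
flips the sign of every term. -/
theorem monicSum_resultantChar_eq_zero (hk : ringChar k ≠ 2) {c : k} {U : k[X]} (hU : U.Monic)
    (hsq : Squarefree U) (hd : 0 < U.natDegree) (hc : c ≠ 0) {m : ℕ} (hm : U.natDegree ≤ m) :
    monicSum (resultantChar (C c * U)) m = 0 := by
  classical
  obtain ⟨b, hb0, hcop, hb⟩ := exists_isCoprime_quadraticChar_resultant_eq_neg_one hk hU hsq hd
  let σ : k[X] → k[X] := fun a => a + (a * (b - 1)) %ₘ U
  have hσdvd : ∀ a, U ∣ σ a - a * b := by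
    intro a
    refine ⟨-(a * (b - 1) /ₘ U), ?_⟩
    have := modByMonic_add_div (a * (b - 1)) U
    simp only [σ]
    linear_combination this
  have hmem : ∀ a ∈ monicOfDegree k m, σ a ∈ monicOfDegree k m := by
    intro a ha
    rw [mem_monicOfDegree] at ha ⊢
    have hlt : ((a * (b - 1)) %ₘ U).degree < a.degree := by
      refine (degree_modByMonic_lt _ hU).trans_le ?_
      rw [degree_eq_natDegree hU.ne_zero, degree_eq_natDegree ha.1.ne_zero, ha.2]
      exact_mod_cast hm
    exact ⟨ha.1.add_of_left hlt, by rw [natDegree_add_eq_left_of_degree_lt hlt, ha.2]⟩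
  refine sum_eq_zero_of_injOn_neg _ _ σ hmem ?_ ?_
  · intro a _ a' _ h
    have h1 : U ∣ (a - a') * b := by
      have := dvd_sub (hσdvd a') (hσdvd a)
      rw [h] at this
      convert this using 1
      ring
    have h2 : U ∣ a - a' := hcop.dvd_of_dvd_mul_right h1
    have h3 : (a * (b - 1)) %ₘ U = (a' * (b - 1)) %ₘ U := by
      rw [← sub_eq_zero, ← sub_modByMonic, modByMonic_eq_zero_iff_dvd hU, ← sub_mul]
      exact h2.mul_right _
    simpa [σ, h3] using h
  · intro a ha
    have hσa := (mem_monicOfDegree.1 (hmem a ha))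
    rw [mem_monicOfDegree] at ha
    rw [resultantChar_eq_mul U hc ha.1, resultantChar_eq_mul U hc hσa.1,
      resultant_eq_mul_of_dvd_sub hU ha.1.ne_zero hb0 (hσdvd a), map_mul _ (resultant U a), hb, hσa.2, ha.2]
    ring

/-- The L-function has a trivial zero at χ(c). The weight χ(c)^m cancels the reciprocity factor,
leaving the sum of χ(Res(U, a)) over all monic a of degree less than deg U. Multiplying by b modulo
U and rescaling to a monic polynomial flips every sign: rescaling by λ only contributes λ^(deg U), a
square in even degree. -/
theorem sum_monicSum_resultantChar_of_even (hk : ringChar k ≠ 2) {c : k} {U : k[X]} (hU : U.Monic)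
    (hsq : Squarefree U) (hd : 0 < U.natDegree) (hc : c ≠ 0) (heven : Even U.natDegree) :
    ∑ m ∈ Finset.range U.natDegree,
      monicSum (resultantChar (C c * U)) m * quadraticChar k c ^ m = 0 := by
  classical
  obtain ⟨b, hb0, hcop, hb⟩ := exists_isCoprime_quadraticChar_resultant_eq_neg_one hk hU hsq hd
  have hU1 : U ≠ 1 := by rintro rfl; simp at hd
  let s : Finset k[X] := (Finset.range U.natDegree).biUnion (monicOfDegree k)
  have hs : ∀ a, a ∈ s ↔ a.Monic ∧ a.natDegree < U.natDegree := by
    intro a; simp [s, and_comm]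
  have h1 : ∑ m ∈ Finset.range U.natDegree,
      monicSum (resultantChar (C c * U)) m * quadraticChar k c ^ m =
      ∑ a ∈ s, quadraticChar k (resultant U a) := by
    rw [Finset.sum_biUnion]
    · refine Finset.sum_congr rfl fun m _ => ?_
      rw [monicSum, Finset.sum_mul]
      refine Finset.sum_congr rfl fun a ha => ?_
      rw [mem_monicOfDegree] at ha
      rw [resultantChar_eq_mul U hc ha.1, ha.2, heven.neg_one_pow, one_mul, mul_right_comm,
        ← mul_pow, ← sq, quadraticChar_sq_one hc, one_pow, one_mul]
    · intro m _ m' _ hmm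
      rw [Function.onFun, Finset.disjoint_left]
      intro a ha ha'
      rw [mem_monicOfDegree] at ha ha'
      exact hmm (ha.2.symm.trans ha'.2)
  rw [h1]
  have hne : ∀ a ∈ s, (a * b) %ₘ U ≠ 0 := by
    intro a ha h
    rw [hs] at ha
    rw [modByMonic_eq_zero_iff_dvd hU] at h
    have := natDegree_le_of_dvd (hcop.dvd_of_dvd_mul_right h) ha.1.ne_zero
    omega
  let l : k[X] → k := fun a => ((a * b) %ₘ U).leadingCoeff⁻¹
  let σ : k[X] → k[X] := fun a => C (l a) * ((a * b) %ₘ U)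
  have hl : ∀ a ∈ s, l a ≠ 0 := fun a ha => inv_ne_zero (leadingCoeff_ne_zero.2 (hne a ha))
  refine sum_eq_zero_of_injOn_neg _ _ σ ?_ ?_ ?_
  · intro a ha
    rw [hs]
    refine ⟨?_, ?_⟩
    · simp only [σ, l]
      rw [mul_comm]
      exact monic_mul_leadingCoeff_inv (hne a ha)
    · simp only [σ]
      rw [natDegree_C_mul (hl a ha)]
      exact natDegree_modByMonic_lt _ hU hU1
  · intro a ha a' ha' h
    have hdvd : ∀ a, U ∣ σ a - C (l a) * a * b := by
      intro a
      refine ⟨-(C (l a) * (a * b /ₘ U)), ?_⟩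
      have := modByMonic_add_div (a * b) U
      simp only [σ]
      linear_combination C (l a) * this
    have h1 : U ∣ (C (l a) * a - C (l a') * a') * b := by
      have := dvd_sub (hdvd a') (hdvd a)
      rw [h] at this
      convert this using 1
      ring
    have h2 := hcop.dvd_of_dvd_mul_right h1
    have ha1 := (hs a).1 ha
    have ha2 := (hs a').1 ha'
    have h3 : C (l a) * a - C (l a') * a' = 0 := by
      refine eq_zero_of_dvd_of_natDegree_lt h2 ?_
      refine (natDegree_sub_le _ _).trans_lt (max_lt ?_ ?_)
      · rw [natDegree_C_mul (hl a ha)]; exact ha1.2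
      · rw [natDegree_C_mul (hl a' ha')]; exact ha2.2
    rw [sub_eq_zero] at h3
    have h4 : l a = l a' := by
      have := congrArg leadingCoeff h3
      simpa [ha1.1.leadingCoeff, ha2.1.leadingCoeff] using this
    rw [h4] at h3
    exact mul_left_cancel₀ (C_ne_zero.2 (hl a' ha')) h3
  · intro a ha
    have ha1 := (hs a).1 ha
    simp only [σ]
    have h2 : U ∣ (a * b) %ₘ U - a * b := ⟨-(a * b /ₘ U), by
      linear_combination modByMonic_add_div (a * b) U⟩
    rw [natDegree_C_mul (hl a ha), resultant_C_mul_right,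
      resultant_eq_mul_of_dvd_sub hU ha1.1.ne_zero hb0 h2, map_mul, map_mul, hb, map_pow]
    obtain ⟨n, hn⟩ := heven
    rw [hn, ← two_mul, pow_mul, quadraticChar_sq_one (hl a ha)]
    simp

end ResultantChar

/-! ### Character sums over extensions and the Hasse–Weil bound -/

/-- Euler's criterion in both fields, combined with N(y) = y^((|L| - 1)/(|k| - 1)). The values 0, 1,
-1 can be compared inside L because its characteristic is odd. -/
theorem quadraticChar_eq_quadraticChar_norm {k L : Type*} [Field k] [Fintype k] [DecidableEq k]
    [Field L] [Fintype L] [DecidableEq L] [Algebra k L] (hk : ringChar k ≠ 2) (y : L) :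
    quadraticChar L y = quadraticChar k (Algebra.norm k y) := by
  have hL : ringChar L ≠ 2 := by
    rwa [← Algebra.ringChar_eq k L]
  have hQ : ∀ a : ℤ, ∀ b : ℤ, (a = 0 ∨ a = 1 ∨ a = -1) → (b = 0 ∨ b = 1 ∨ b = -1) →
      (a : L) = b → a = b := by
    have h2 : (2 : L) ≠ 0 := Ring.two_ne_zero hL
    rintro a b (rfl | rfl | rfl) (rfl | rfl | rfl) h <;> simp at h ⊢
    · exact h2 (by linear_combination h)
    · exact h2 (by linear_combination -h)
  refine hQ _ _ (quadraticChar_isQuadratic L y) (quadraticChar_isQuadratic k _) ?_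
  rw [quadraticChar_eq_pow_of_char_ne_two' hL]
  have h1 := congrArg (algebraMap k L) (quadraticChar_eq_pow_of_char_ne_two' hk (Algebra.norm k y))
  rw [map_intCast, map_pow, FiniteField.algebraMap_norm_eq_pow, ← pow_mul] at h1
  rw [h1]
  congr 1
  have hk1 := FiniteField.odd_card_of_char_ne_two hk
  have hL1 := FiniteField.odd_card_of_char_ne_two hL
  rw [Nat.card_eq_fintype_card, Nat.card_eq_fintype_card]
  have hcard : Fintype.card L = Fintype.card k ^ Module.finrank k L := Module.card_eq_pow_finrank
  have hdvd : Fintype.card k - 1 ∣ Fintype.card L - 1 := by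
    rw [hcard]
    simpa using Nat.sub_dvd_pow_sub_pow (Fintype.card k) 1 (Module.finrank k L)
  obtain ⟨w, hw⟩ := hdvd
  have hk2 : 1 < Fintype.card k := Fintype.one_lt_card
  rw [hw, Nat.mul_div_cancel_left _ (by omega)]
  obtain ⟨t, ht⟩ : ∃ t, Fintype.card k = 2 * t + 1 := ⟨Fintype.card k / 2, by omega⟩
  have h3 : Fintype.card k / 2 = t := by omega
  rw [ht, Nat.add_sub_cancel] at hw
  rw [h3]
  have h4 : 2 * t * w = 2 * (w * t) := by ring
  omega

theorem card_filter_minpoly_eq {k L : Type*} [Field k] [Finite k] [Field L] [Fintype L]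
    [Algebra k L] [DecidableEq k[X]] {P : k[X]} (hP : P.Monic) (hi : Irreducible P)
    (hdvd : P.natDegree ∣ Module.finrank k L) :
    (Finset.univ.filter fun x : L => minpoly k x = P).card = P.natDegree := by
  classical
  have hPL : P.map (algebraMap k L) ≠ 0 := (hP.map _).ne_zero
  have hcard : Fintype.card L = Nat.card k ^ Module.finrank k L := by
    rw [← Nat.card_eq_fintype_card]; exact Module.natCard_eq_pow_finrank
  have hsplit : (P.map (algebraMap k L)).Splits := by
    have h1 := hi.natDegree_dvd_iff_dvd_X_pow_card_pow_sub_X.1 hdvd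
    rw [← hcard] at h1
    refine Splits.of_dvd (g := (X ^ Fintype.card L - X : L[X])) ?_ ?_ ?_
    · rw [splits_iff_card_roots, FiniteField.roots_X_pow_card_sub_X,
        FiniteField.X_pow_card_sub_X_natDegree_eq _ Fintype.one_lt_card]
      rfl
    · exact FiniteField.X_pow_card_sub_X_ne_zero _ Fintype.one_lt_card
    · simpa using map_dvd (algebraMap k L) h1
  have hnodup : (P.map (algebraMap k L)).roots.Nodup :=
    nodup_roots ((PerfectField.separable_of_irreducible hi).map)
  have : (Finset.univ.filter fun x : L => minpoly k x = P) =
      (P.map (algebraMap k L)).roots.toFinset := by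
    ext x
    simp only [Finset.mem_filter, Finset.mem_univ, true_and, Multiset.mem_toFinset,
      mem_roots hPL, IsRoot.def, eval_map_algebraMap]
    constructor
    · rintro rfl
      exact minpoly.aeval k x
    · intro h
      exact (minpoly.eq_of_irreducible_of_monic hi h hP).symm
  rw [this, Multiset.toFinset_card_of_nodup hnodup, splits_iff_card_roots.1 hsplit, natDegree_map]

/-- The elements x of L are grouped by minimal polynomial P. Each P of degree dividing r = [L : k]
has exactly deg P roots in L, and at each of them χ_L(U(x)) = χ(N(U(x))) = χ(Res(P, U))^(r / deg P).
-/
theorem eulerPowerSum_resultantChar {k L : Type*} [Field k] [Fintype k] [DecidableEq k]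
    [Field L] [Fintype L] [DecidableEq L] [Algebra k L] (hk : ringChar k ≠ 2) (U : k[X]) :
    eulerPowerSum (resultantChar U) (Module.finrank k L) =
      ∑ x : L, quadraticChar L (aeval x U) := by
  classical
  set r := Module.finrank k L with hr
  have hr0 : r ≠ 0 := Module.finrank_pos.ne'
  have hmon : ∀ x : L, (minpoly k x).Monic := fun x =>
    minpoly.monic (Algebra.IsIntegral.isIntegral x)
  have hdeg : ∀ x : L, (minpoly k x).natDegree ∣ r := fun x =>
    minpoly.degree_dvd (Algebra.IsIntegral.isIntegral x)
  have h1 : ∀ x : L, quadraticChar L (aeval x U) =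
      resultantChar U (minpoly k x) ^ (r / (minpoly k x).natDegree) := by
    intro x
    rw [quadraticChar_eq_quadraticChar_norm hk, norm_aeval_eq_resultant_pow, map_pow,
      resultantChar_of_monic _ (hmon x)]
  rw [Finset.sum_congr rfl (fun x _ => h1 x), eulerPowerSum, Finset.sum_sigma']
  symm
  refine (Finset.sum_fiberwise_of_maps_to (t := r.divisorsAntidiagonal.sigma
    fun x => irreducibleOfDegree k x.1) (g := fun x : L => (⟨((minpoly k x).natDegree,
      r / (minpoly k x).natDegree), minpoly k x⟩ : (_ : ℕ × ℕ) × k[X])) ?_ _).symm.trans ?_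
  · intro x _
    simp only [Finset.mem_sigma, Nat.mem_divisorsAntidiagonal, mem_irreducibleOfDegree]
    exact ⟨⟨Nat.mul_div_cancel' (hdeg x), hr0⟩, ⟨hmon x, trivial⟩,
      minpoly.irreducible (Algebra.IsIntegral.isIntegral x)⟩
  · refine Finset.sum_congr rfl ?_
    rintro ⟨⟨d, e⟩, P⟩ hP
    simp only [Finset.mem_sigma, Nat.mem_divisorsAntidiagonal, mem_irreducibleOfDegree] at hP
    obtain ⟨⟨hde, -⟩, ⟨hPm, rfl⟩, hPi⟩ := hP
    have he : r / P.natDegree = e := by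
      rw [← hde, Nat.mul_div_cancel_left _ hPi.natDegree_pos]
    have hfil : (Finset.univ.filter fun x : L => (⟨((minpoly k x).natDegree,
        r / (minpoly k x).natDegree), minpoly k x⟩ : (_ : ℕ × ℕ) × k[X]) = ⟨(P.natDegree, e), P⟩) =
        Finset.univ.filter fun x : L => minpoly k x = P := by
      ext x
      simp only [Finset.mem_filter, Finset.mem_univ, true_and, Sigma.mk.injEq, Prod.mk.injEq,
        heq_eq_eq]
      constructor
      · exact fun h => h.2
      · rintro rfl
        exact ⟨⟨rfl, he⟩, rfl⟩
    rw [hfil, Finset.sum_congr rfl (g := fun _ => resultantChar U P ^ e), Finset.sum_const,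
      card_filter_minpoly_eq hPm hPi (Dvd.intro _ hde), nsmul_eq_mul]
    intro x hx
    rw [(Finset.mem_filter.1 hx).2, he]

theorem ne_C_mul_sq_of_squarefree {k L : Type*} [Field k] [Finite k] [Field L] [Algebra k L]
    {U : k[X]} (hsq : Squarefree U) (hd : 0 < U.natDegree) (c : L) (h : L[X]) :
    U.map (algebraMap k L) ≠ C c * h ^ 2 := by
  intro heq
  have hsqL : Squarefree (U.map (algebraMap k L)) :=
    ((PerfectField.separable_iff_squarefree.2 hsq).map).squarefree
  have hu : IsUnit h := hsqL h ⟨C c, by rw [heq]; ring⟩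
  have h1 := congrArg natDegree heq
  rw [natDegree_map] at h1
  have h2 := natDegree_C_mul_le c (h ^ 2)
  rw [natDegree_pow, natDegree_eq_zero_of_isUnit hu] at h2
  omega

theorem exists_frobenius_eigenvalues {k : Type*} [Field k] [Fintype k] [DecidableEq k]
    (hk : ringChar k ≠ 2) {U : k[X]} (hsq : Squarefree U) (hd : 0 < U.natDegree) :
    ∃ ω : Fin (U.natDegree - 1) → ℂ, (∀ i, ‖ω i‖ ≤ √(Fintype.card k)) ∧
      ((∑ x : k, quadraticChar k (U.eval x) : ℤ) : ℂ) = - ∑ i, ω i ∧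
      (Even U.natDegree → ∃ i, ω i = (quadraticChar k U.leadingCoeff : ℤ)) := by
  have hU0 : U ≠ 0 := by rintro rfl; simp at hd
  set c := U.leadingCoeff with hc
  have hc0 : c ≠ 0 := leadingCoeff_ne_zero.2 hU0
  obtain ⟨V, hV, hVm⟩ : ∃ V : k[X], U = C c * V ∧ V.Monic :=
    ⟨C c⁻¹ * U, by rw [← mul_assoc, ← C_mul, mul_inv_cancel₀ hc0]; simp,
      by rw [mul_comm]; exact monic_mul_leadingCoeff_inv hU0⟩
  have hVd : V.natDegree = U.natDegree := by rw [hV, natDegree_C_mul hc0]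
  have hVsq : Squarefree V := hsq.squarefree_of_dvd ⟨C c, by rw [hV, mul_comm]⟩
  set ψ := resultantChar U with hψ
  set d := U.natDegree with hd'
  have hvan : ∀ m, d ≤ m → monicSum ψ m = 0 := fun m hm => by
    rw [hψ, hV]
    exact monicSum_resultantChar_eq_zero hk hVm hVsq (hVd ▸ hd) hc0 (hVd ▸ hm)
  obtain ⟨ω, hω1, hω2⟩ := exists_power_sums_of_newton d hd (fun m => ((monicSum ψ m : ℤ) : ℂ))
    (fun r => ((eulerPowerSum ψ r : ℤ) : ℂ)) (by simp [monicSum_zero])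
    (fun m hm => by simp [hvan m hm])
    (fun m => by exact_mod_cast mul_monicSum ψ m)
  refine ⟨ω, ?_, ?_, ?_⟩
  · obtain ⟨p, hp⟩ := CharP.exists k
    have hprime : Fact p.Prime := ⟨CharP.char_is_prime k p⟩
    have hp2 : p ≠ 2 := by rwa [← ringChar.eq k p]
    obtain ⟨s, -, hs⟩ := FiniteField.card k p
    set q := Fintype.card k with hq
    have hq1 : 1 < q := Fintype.one_lt_card
    -- Stepanov's bound needs a field of square order, so only extensions of degree 2n are used and
    -- the growth criterion is applied to the ω_i². The threshold on n gives the required 4d + 7 ≤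
    -- q^n through n ≤ q^n.
    have hbound : ∀ n : ℕ, 4 * d + 7 ≤ n →
        ‖∑ i, (ω i ^ 2) ^ n‖ ≤ (5 * d + 8 : ℝ) * (q : ℝ) ^ n := by
      intro n hn
      have hnz : NeZero (2 * n) := ⟨by omega⟩
      let L := FiniteField.Extension k p (2 * n)
      let _ : Fintype L := Fintype.ofFinite L
      let _ : DecidableEq L := Classical.decEq L
      have : CharP L p := charP_of_injective_algebraMap (algebraMap k L).injective p
      have hfr : Module.finrank k L = 2 * n := FiniteField.finrank_extension k p (2 * n)
      have hcardL : Fintype.card L = (p ^ ((s : ℕ) * n)) ^ 2 := by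
        rw [← Nat.card_eq_fintype_card, FiniteField.natCard_extension, Nat.card_eq_fintype_card,
          ← hq, hs]
        ring
      have hpq : p ^ ((s : ℕ) * n) = q ^ n := by rw [hs, pow_mul]
      have hle : n ≤ q ^ n := (Nat.lt_pow_self hq1).le
      have h1 := abs_sum_quadraticChar_eval_le p ((s : ℕ) * n) hp2 (U.map (algebraMap k L))
        (ne_C_mul_sq_of_squarefree hsq hd) hcardL (by rw [natDegree_map, hpq]; omega)
      simp only [eval_map_algebraMap, natDegree_map] at h1
      rw [← eulerPowerSum_resultantChar hk U, hfr] at h1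
      have h2 := hω2 (2 * n) (by omega)
      have h3 : ∑ i, (ω i ^ 2) ^ n = - ((eulerPowerSum ψ (2 * n) : ℤ) : ℂ) := by
        rw [h2, neg_neg]
        simp_rw [pow_mul]
      rw [h3, norm_neg, Complex.norm_intCast]
      have h4 : ((p : ℤ) ^ ((s : ℕ) * n)) = (q : ℤ) ^ n := by exact_mod_cast hpq
      rw [h4] at h1
      have h5 : ((|eulerPowerSum ψ (2 * n)| : ℤ) : ℝ) ≤ (((q : ℤ) ^ n * (5 * d + 8) : ℤ) : ℝ) := by
        exact_mod_cast h1
      push_cast at h5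
      linarith
    intro i
    have h1 := norm_le_of_norm_sum_pow_le (fun i => ω i ^ 2) q (5 * d + 8)
      (by positivity) (4 * d + 7) hbound i
    rw [norm_pow] at h1
    exact Real.le_sqrt_of_sq_le h1
  · have h1 := hω2 1 le_rfl
    have h2 := eulerPowerSum_resultantChar (L := k) hk U
    rw [Module.finrank_self, ← hψ] at h2
    rw [h2] at h1
    simpa only [pow_one, coe_aeval_eq_eval] using h1
  · intro heven
    have h1 := sum_monicSum_resultantChar_of_even hk hVm hVsq (hVd ▸ hd) hc0 (hVd ▸ heven)
    rw [← hV, hVd] at h1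
    have h2 := hω1 (quadraticChar k c : ℤ)
    have hsq1 : (quadraticChar k c) ^ 2 = 1 := quadraticChar_sq_one hc0
    -- As χ(c) = ±1 is its own inverse, reversing the coefficients only multiplies the value at χ(c)
    -- by χ(c)^(d - 1).
    have h3 : ∑ m ∈ Finset.range d, monicSum ψ m * quadraticChar k c ^ (d - 1 - m) = 0 := by
      have : ∀ m ∈ Finset.range d, monicSum ψ m * quadraticChar k c ^ (d - 1 - m) =
          quadraticChar k c ^ (d - 1) * (monicSum ψ m * quadraticChar k c ^ m) := by
        intro m hm
        rw [Finset.mem_range] at hm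
        have h4 : quadraticChar k c ^ (d - 1) =
            quadraticChar k c ^ (d - 1 - m) * quadraticChar k c ^ m := by
          rw [← pow_add]; congr 1; omega
        have h5 : quadraticChar k c ^ m * quadraticChar k c ^ m = 1 := by
          rw [← mul_pow, ← sq, hsq1, one_pow]
        rw [h4]
        linear_combination (-(monicSum ψ m) * quadraticChar k c ^ (d - 1 - m)) * h5
      rw [Finset.sum_congr rfl this, ← Finset.mul_sum, h1, mul_zero]
    have h4 : ∏ i, (((quadraticChar k c : ℤ) : ℂ) - ω i) = 0 := by
      rw [← h2]
      exact_mod_cast congrArg (Int.cast : ℤ → ℂ) h3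
    obtain ⟨i, -, hi⟩ := Finset.prod_eq_zero_iff.1 h4
    exact ⟨i, (sub_eq_zero.1 hi).symm⟩

/-- The Hasse-Weil bound for the hyperelliptic curve `y ^ 2 = U(x)` over a finite field. -/
theorem abs_sum_quadraticChar_eval_le_sqrt {k : Type*} [Field k] [Fintype k] [DecidableEq k]
    (hk : ringChar k ≠ 2) {U : k[X]} (hsq : Squarefree U) (hd : 0 < U.natDegree) :
    |((∑ x : k, quadraticChar k (U.eval x) : ℤ) : ℝ) +
      (if Even U.natDegree then quadraticChar k U.leadingCoeff else 0 : ℤ)| ≤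
      2 * ((U.natDegree - 1) / 2 : ℕ) * √(Fintype.card k) := by
  obtain ⟨ω, hω, hS, htriv⟩ := exists_frobenius_eigenvalues hk hsq hd
  have hnorm : ∀ z : ℤ, |(z : ℝ)| = ‖(z : ℂ)‖ := fun z => by rw [Complex.norm_intCast]
  rw [← Int.cast_add, hnorm, Int.cast_add, hS]
  split_ifs with heven
  -- The term χ of the leading coefficient cancels the trivial eigenvalue, leaving deg U - 2
  -- eigenvalues of size at most √q.
  · obtain ⟨i, hi⟩ := htriv heven
    rw [← hi, ← Finset.add_sum_erase _ _ (Finset.mem_univ i), neg_add_rev, neg_add_cancel_right,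
      norm_neg]
    refine (norm_sum_le_of_le _ fun j _ => hω j).trans ?_
    rw [Finset.sum_const, Finset.card_erase_of_mem (Finset.mem_univ i), Finset.card_univ,
      Fintype.card_fin, nsmul_eq_mul]
    refine mul_le_mul_of_nonneg_right ?_ (Real.sqrt_nonneg _)
    obtain ⟨n, hn⟩ := heven
    exact_mod_cast (by omega : U.natDegree - 1 - 1 ≤ 2 * ((U.natDegree - 1) / 2))
  · rw [Int.cast_zero, add_zero, norm_neg]
    refine (norm_sum_le_of_le _ fun j _ => hω j).trans ?_
    rw [Finset.sum_const, Finset.card_univ, Fintype.card_fin, nsmul_eq_mul]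
    refine mul_le_mul_of_nonneg_right ?_ (Real.sqrt_nonneg _)
    rw [Nat.not_even_iff_odd] at heven
    obtain ⟨n, hn⟩ := heven
    exact_mod_cast (by omega : U.natDegree - 1 ≤ 2 * ((U.natDegree - 1) / 2))

/-! ### Smooth points on the reduction -/

theorem exists_squarefree_mul_sq {k : Type*} [Field k] {F : k[X]} (hF : F ≠ 0) :
    ∃ U h : k[X], Squarefree U ∧ F = U * h ^ 2 := by
  induction hn : F.natDegree using Nat.strong_induction_on generalizing F with
  | _ n ih =>
    by_cases hsq : Squarefree F
    · exact ⟨F, 1, hsq, by ring⟩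
    · simp only [Squarefree, not_forall] at hsq
      obtain ⟨a, ⟨b, rfl⟩, ha⟩ := hsq
      have hb0 : b ≠ 0 := right_ne_zero_of_mul hF
      have ha0 : a ≠ 0 := by rintro rfl; simp at hF
      have hadeg : 0 < a.natDegree := by
        rw [Nat.pos_iff_ne_zero]
        intro h
        rw [natDegree_eq_zero] at h
        obtain ⟨c, rfl⟩ := h
        exact ha (isUnit_C.2 (isUnit_iff_ne_zero.2 (by simpa using ha0)))
      obtain ⟨U, h, hU, rfl⟩ := ih b.natDegree (by
        rw [natDegree_mul (mul_ne_zero ha0 ha0) hb0, natDegree_mul ha0 ha0] at hn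
        omega) hb0 rfl
      exact ⟨U, a * h, hU, by ring⟩

/-- A value `x` for which `y ^ 2 = F(x)` has a nonsingular solution. -/
def HasSmoothPointAt {k : Type*} [Field k] (F : k[X]) (x : k) : Prop :=
  (F.eval x = 0 ∧ F.derivative.eval x ≠ 0) ∨ ∃ y ≠ 0, y ^ 2 = F.eval x

theorem quadraticChar_eval_eq_neg_one {k : Type*} [Field k] [Fintype k] [DecidableEq k]
    {U h : k[X]} (hU : Squarefree U) {x : k} (hx : h.eval x ≠ 0)
    (hns : ¬ HasSmoothPointAt (U * h ^ 2) x) : quadraticChar k (U.eval x) = -1 := by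
  rw [quadraticChar_neg_one_iff_not_isSquare]
  rintro ⟨z, hz⟩
  by_cases hz0 : z = 0
  · rw [hz0, mul_zero] at hz
    refine hns (Or.inl ⟨by simp [hz], ?_⟩)
    have h1 : U.derivative.eval x ≠ 0 := by
      simpa using (PerfectField.separable_iff_squarefree.2 hU).eval₂_derivative_ne_zero
        (RingHom.id k) (x := x) (by simpa using hz)
    simp [derivative_mul, hz, h1, hx]
  · exact hns (Or.inr ⟨z * h.eval x, mul_ne_zero hz0 hx, by simp [hz]; ring⟩)

/-- Since √q ≥ 1, the right side is at most 2g√q. Squaring gives (q + 1)² ≤ 4g² q ≤ (q + 1) q, which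
is absurd. -/
theorem sqrt_bound_contradiction {q g m : ℕ} (hg : 1 ≤ g) (hmg : m ≤ g)
    (hq : 4 * (g : ℤ) ^ 2 - 2 < q) (h : (q : ℝ) + 1 ≤ 2 * m * √q + 2 * (g - m)) : False := by
  have hq1 : 4 * (g : ℝ) ^ 2 ≤ q + 1 := by
    have : 4 * (g : ℤ) ^ 2 ≤ q + 1 := by omega
    exact_mod_cast this
  have hg1 : (1 : ℝ) ≤ g := by exact_mod_cast hg
  have hmg' : (m : ℝ) ≤ g := by exact_mod_cast hmg
  set r := √(q : ℝ) with hr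
  have hr2 : r ^ 2 = q := Real.sq_sqrt (by positivity)
  have hr1 : 1 ≤ r := by
    rw [hr, Real.one_le_sqrt]
    nlinarith
  rw [← hr2] at h hq1
  have h1 : r ^ 2 + 1 ≤ 2 * g * r := by nlinarith
  have h2 : (r ^ 2 + 1) ^ 2 ≤ (2 * g * r) ^ 2 := by gcongr
  nlinarith [mul_le_mul_of_nonneg_right hq1 (sq_nonneg r)]

theorem exists_smooth_point {k : Type*} [Field k] [Fintype k] [DecidableEq k] (hk : ringChar k ≠ 2)
    {g : ℕ} (hg : 1 ≤ g) (hq : 4 * (g : ℤ) ^ 2 - 2 < Fintype.card k) {F : k[X]}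
    (hdeg : F.natDegree ≤ 2 * g + 2)
    (hF : ∀ (c : k) (h : k[X]), ¬ IsSquare c → F ≠ C c * h ^ 2) :
    (∃ x, HasSmoothPointAt F x) ∨ HasSmoothPointAt (F.reflect (2 * g + 2)) 0 := by
  by_contra! hcon
  obtain ⟨hfin, hinf⟩ := hcon
  have hF0 : F ≠ 0 := by
    obtain ⟨c, hc⟩ := FiniteField.exists_nonsquare hk
    have := hF c 0 hc
    simpa using this
  obtain ⟨U, h, hU, rfl⟩ := exists_squarefree_mul_sq hF0
  set q := Fintype.card k with hq'
  have hU0 : U ≠ 0 := hU.ne_zero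
  have hh0 : h ≠ 0 := by rintro rfl; simp at hF0
  have hdegF : (U * h ^ 2).natDegree = U.natDegree + 2 * h.natDegree := by
    rw [natDegree_mul hU0 (pow_ne_zero _ hh0), natDegree_pow]
  have hinf1 : (U * h ^ 2).coeff (2 * g + 2) = 0 → (U * h ^ 2).coeff (2 * g + 1) = 0 := by
    intro h1
    by_contra h2
    refine hinf (Or.inl ⟨?_, ?_⟩)
    · rw [← coeff_zero_eq_eval_zero, coeff_reflect]
      simpa [revAt_le] using h1
    · rw [← coeff_zero_eq_eval_zero, coeff_derivative, coeff_reflect, revAt_le (by omega)]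
      simpa using h2
  have hinf2 : ∀ y, y ≠ 0 → y ^ 2 ≠ (U * h ^ 2).coeff (2 * g + 2) := by
    intro y hy hy2
    refine hinf (Or.inr ⟨y, hy, ?_⟩)
    rw [← coeff_zero_eq_eval_zero, coeff_reflect, hy2]
    simp [revAt_le]
  -- In degree 2g + 1 the binary form has a simple zero at infinity, which is a smooth point.
  have hdeg' : U.natDegree + 2 * h.natDegree ≠ 2 * g + 1 := by
    intro heq
    have h1 : (U * h ^ 2).coeff (2 * g + 1) ≠ 0 := by
      rw [← heq, ← hdegF, coeff_natDegree]
      exact leadingCoeff_ne_zero.2 hF0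
    exact h1 (hinf1 (coeff_eq_zero_of_natDegree_lt (by omega)))
  have hlc : U.natDegree + 2 * h.natDegree = 2 * g + 2 → quadraticChar k U.leadingCoeff = -1 := by
    intro heq
    rw [quadraticChar_neg_one_iff_not_isSquare]
    rintro ⟨z, hz⟩
    have hz0 : z ≠ 0 := by
      rintro rfl
      exact hU0 (leadingCoeff_eq_zero.1 (by simpa using hz))
    refine hinf2 (z * h.leadingCoeff) (mul_ne_zero hz0 (leadingCoeff_ne_zero.2 hh0)) ?_
    rw [← heq, ← hdegF, coeff_natDegree, leadingCoeff_mul, leadingCoeff_pow, hz]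
    ring
  have hq2 : 4 * (g : ℤ) ^ 2 ≤ q + 1 := by omega
  set Z := ({x | h.eval x = 0} : Finset k) with hZ
  have hZcard : Z.card ≤ h.natDegree := by
    refine card_le_degree_of_subset_roots fun x hx => ?_
    rw [mem_roots hh0]
    simpa [hZ] using hx
  have hneg : ∀ x, x ∉ Z → quadraticChar k (U.eval x) = -1 := fun x hx =>
    quadraticChar_eval_eq_neg_one hU (by simpa [hZ] using hx) (hfin x)
  rw [hdegF] at hdeg
  -- For constant U = c, some x is not a root of h because deg h ≤ g + 1 < q. There c must be a
  -- nonsquare, which is the excluded shape.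
  by_cases hd : U.natDegree = 0
  · obtain ⟨c, rfl⟩ := natDegree_eq_zero.1 hd
    have hlt : Z.card < q := by
      have : h.natDegree < q := by
        zify
        have : (h.natDegree : ℤ) ≤ g + 1 := by omega
        have : (1 : ℤ) ≤ g := by exact_mod_cast hg
        nlinarith
      omega
    obtain ⟨x, hx⟩ : ∃ x, x ∉ Z := by
      by_contra! hall
      rw [Finset.eq_univ_iff_forall.2 hall, Finset.card_univ] at hlt
      exact lt_irrefl _ hlt
    have := hneg x hx
    rw [eval_C, quadraticChar_neg_one_iff_not_isSquare] at this
    exact hF c h this rfl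
  · have hbound := abs_sum_quadraticChar_eval_le_sqrt hk hU (Nat.pos_of_ne_zero hd)
    set m := (U.natDegree - 1) / 2 with hm
    have hsum : ∑ x : k, quadraticChar k (U.eval x) ≤ -(q : ℤ) + 2 * h.natDegree := by
      -- A zero of h can raise its term from -1 to at most 1.
      have h1 : ∀ x : k, quadraticChar k (U.eval x) ≤ -1 + if x ∈ Z then 2 else 0 := by
        intro x
        split_ifs with hx
        · rcases quadraticChar_isQuadratic k (U.eval x) with h | h | h <;> rw [h] <;> norm_num
        · rw [hneg x hx]; norm_num
      refine (Finset.sum_le_sum fun x _ => h1 x).trans ?_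
      rw [Finset.sum_add_distrib, Finset.sum_const, Finset.card_univ, ← hq', Finset.sum_ite_mem,
        Finset.univ_inter, Finset.sum_const, nsmul_eq_mul, nsmul_eq_mul]
      have : (Z.card : ℤ) ≤ h.natDegree := by exact_mod_cast hZcard
      linarith
    have hmg : m ≤ g := by omega
    -- If deg U = 2m + 2, then deg h ≤ g - m. Equality means total degree 2g + 2, where the leading
    -- coefficient has character -1; otherwise deg h is smaller by at least one, which outweighs a
    -- character of 1. If deg U = 2m + 1, the total degree is odd and not 2g + 1, so deg h ≤ g - m -
    -- 1.
    have key : (∑ x : k, quadraticChar k (U.eval x)) +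
        (if Even U.natDegree then quadraticChar k U.leadingCoeff else 0) ≤
        -(q : ℤ) - 1 + 2 * (g - m) := by
      split_ifs with heven
      · obtain ⟨n, hn⟩ := heven
        by_cases htop : U.natDegree + 2 * h.natDegree = 2 * g + 2
        · rw [hlc htop]
          omega
        · have h1 : quadraticChar k U.leadingCoeff ≤ 1 := by
            rcases quadraticChar_isQuadratic k U.leadingCoeff with h | h | h <;> rw [h] <;> norm_num
          omega
      · rw [Nat.not_even_iff_odd] at heven
        obtain ⟨n, hn⟩ := heven
        omega
    have h1 := (abs_le.1 hbound).1
    have h2 : (((∑ x : k, quadraticChar k (U.eval x)) +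
        (if Even U.natDegree then quadraticChar k U.leadingCoeff else 0) : ℤ) : ℝ) ≤
        ((-(q : ℤ) - 1 + 2 * (g - m) : ℤ) : ℝ) := by exact_mod_cast key
    rw [Int.cast_add] at h2
    push_cast [-Int.cast_sum, -Int.cast_ite] at h1 h2
    exact sqrt_bound_contradiction hg hmg hq (by rw [← hq'] at h1; linarith)

/-! ### Hensel lifting into the completion -/

theorem Valued.nonarchimedeanAddGroup (R : Type*) {Γ₀ : Type*} [Ring R]
    [LinearOrderedCommGroupWithZero Γ₀] [Valued R Γ₀] : NonarchimedeanAddGroup R where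
  is_nonarchimedean U hU := by
    obtain ⟨γ, hγ⟩ := Valued.mem_nhds_zero.1 hU
    refine ⟨⟨Valued.v.restrict.ltAddSubgroup γ, ?_⟩, fun x hx => hγ hx⟩
    exact AddSubgroup.isOpen_of_mem_nhds _ (g := 0) (Valued.mem_nhds_zero.2 ⟨γ, fun x hx => hx⟩)

section Hensel

open IsDedekindDomain Filter Topology

variable {R : Type*} [CommRing R]

/-- Newton iteration with the fixed slope u, an inverse of G'(a) modulo I, so that the sequence
stays in R, where G' need not be invertible. Each step gains one factor of I: the linear error is
multiplied by 1 - u G'(x_n) ∈ I, and the rest is divisible by G(x_n)². -/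
theorem exists_hensel_seq (I : Ideal R) (G : R[X]) (a u : R) (h0 : G.eval a ∈ I)
    (h1 : 1 - u * G.derivative.eval a ∈ I) :
    ∃ x : ℕ → R, ∀ n, G.eval (x n) ∈ I ^ (n + 1) ∧ x (n + 1) - x n ∈ I ^ (n + 1) := by
  let x : ℕ → R := fun n => Nat.rec a (fun _ y => y - u * G.eval y) n
  have hx : ∀ n, x (n + 1) = x n + - (u * G.eval (x n)) := fun n => sub_eq_add_neg _ _
  have key : ∀ n, G.eval (x n) ∈ I ^ (n + 1) ∧ x n - a ∈ I := by
    intro n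
    induction n with
    | zero => exact ⟨by simpa [x] using h0, by simp [x]⟩
    | succ n ih =>
      obtain ⟨ih1, ih2⟩ := ih
      have hI : G.eval (x n) ∈ I := Ideal.pow_le_self (Nat.succ_ne_zero n) ih1
      obtain ⟨e, he⟩ := G.binomExpansion (x n) (-(u * G.eval (x n)))
      refine ⟨?_, ?_⟩
      · obtain ⟨w, hw⟩ := sub_dvd_eval_sub (x n) a G.derivative
        have h2 : 1 - u * G.derivative.eval (x n) ∈ I := by
          have h3 : 1 - u * G.derivative.eval (x n) =
              (1 - u * G.derivative.eval a) - (x n - a) * (u * w) := by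
            linear_combination (-u) * hw
          rw [h3]
          exact I.sub_mem h1 (I.mul_mem_right _ ih2)
        have h4 : G.eval (x (n + 1)) = G.eval (x n) * (1 - u * G.derivative.eval (x n)) +
            G.eval (x n) * G.eval (x n) * (e * u ^ 2) := by
          rw [hx, he]; ring
        rw [h4, pow_succ I (n + 1)]
        exact Ideal.add_mem _ (Ideal.mul_mem_mul ih1 h2)
          (Ideal.mul_mem_right _ _ (Ideal.mul_mem_mul ih1 hI))
      · rw [hx, add_sub_right_comm]
        exact I.add_mem ih2 (I.neg_mem (I.mul_mem_left _ hI))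
  refine ⟨x, fun n => ⟨(key n).1, ?_⟩⟩
  rw [hx, add_sub_cancel_left]
  exact neg_mem (Ideal.mul_mem_left _ _ (key n).1)

variable [IsDedekindDomain R] (K : Type*) [Field K] [Algebra R K] [IsFractionRing R K]

theorem tendsto_algebraMap_adicCompletion_zero (v : HeightOneSpectrum R) {y : ℕ → R}
    (hy : ∀ n, y n ∈ v.asIdeal ^ (n + 1)) :
    Tendsto (fun n => algebraMap R (v.adicCompletion K) (y n)) atTop (𝓝 0) := by
  rw [(Valued.hasBasis_nhds_zero (v.adicCompletion K) _).tendsto_right_iff]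
  rintro γ -
  have hval : ∀ n, Valued.v (algebraMap R (v.adicCompletion K) (y n)) ≤
      WithZero.exp (-((n + 1 : ℕ) : ℤ)) := by
    intro n
    have h1 : Valued.v (algebraMap R (v.adicCompletion K) (y n)) = v.intValuation (y n) := by
      rw [← v.valuation_of_algebraMap (K := K), ← v.valuedAdicCompletion_eq_valuation]
    rw [h1, v.intValuation_le_pow_iff_mem]
    exact hy n
  set δ := MonoidWithZeroHom.ValueGroup₀.embedding γ.1 with hδ
  have hδ0 : δ ≠ 0 := by
    rw [hδ, _root_.map_ne_zero]
    exact γ.ne_zero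
  filter_upwards [eventually_ge_atTop (-(WithZero.log δ)).toNat] with n hn
  rw [Valuation.restrict_lt_iff_lt_embedding]
  refine (hval n).trans_lt ?_
  rw [← hδ, ← WithZero.exp_log hδ0, WithZero.exp_lt_exp]
  omega

theorem exists_aeval_adicCompletion_eq_zero (v : HeightOneSpectrum R) (G : R[X]) (a : R)
    (h0 : G.eval a ∈ v.asIdeal) (h1 : G.derivative.eval a ∉ v.asIdeal) :
    ∃ z : v.adicCompletion K, aeval z G = 0 := by
  have hmax : v.asIdeal.IsMaximal := v.isMaximal
  obtain ⟨u, i, hi, hu⟩ := hmax.exists_inv h1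
  obtain ⟨x, hx⟩ := exists_hensel_seq v.asIdeal G a u h0
    (by rwa [← hu, add_sub_cancel_left])
  have := Valued.nonarchimedeanAddGroup (v.adicCompletion K)
  have hcau : CauchySeq fun n => algebraMap R (v.adicCompletion K) (x n) := by
    apply NonarchimedeanAddGroup.cauchySeq_of_tendsto_sub_nhds_zero
    simp_rw [← map_sub]
    exact tendsto_algebraMap_adicCompletion_zero K v fun n => (hx n).2
  obtain ⟨z, hz⟩ := cauchySeq_tendsto_of_complete hcau
  refine ⟨z, ?_⟩
  have h2 : Tendsto (fun n => aeval (algebraMap R (v.adicCompletion K) (x n)) G) atTop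
      (𝓝 (aeval z G)) := ((G.continuous_aeval).tendsto z).comp hz
  refine tendsto_nhds_unique h2 ?_
  simp_rw [aeval_algebraMap_apply, coe_aeval_eq_eval]
  exact tendsto_algebraMap_adicCompletion_zero K v fun n => (hx n).1

/-- A simple root of the reduction is lifted as a root of G, with y = 0. When y ≠ 0, the abscissa a
is kept and y is lifted as a root of Y² - G(a), whose derivative 2y is nonzero in odd
characteristic. -/
theorem exists_sq_eq_aeval_adicCompletion (v : HeightOneSpectrum R)
    (h2 : (2 : R) ∉ v.asIdeal) (G : R[X]) (x : R ⧸ v.asIdeal)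
    (hx : ((G.map (Ideal.Quotient.mk v.asIdeal)).eval x = 0 ∧
      (G.map (Ideal.Quotient.mk v.asIdeal)).derivative.eval x ≠ 0) ∨
      ∃ y ≠ 0, y ^ 2 = (G.map (Ideal.Quotient.mk v.asIdeal)).eval x) :
    ∃ z y : v.adicCompletion K, y ^ 2 = aeval z G := by
  obtain ⟨a, rfl⟩ := Ideal.Quotient.mk_surjective x
  simp only [derivative_map, eval_map_apply, ne_eq, Ideal.Quotient.eq_zero_iff_mem] at hx
  rcases hx with ⟨hx1, hx2⟩ | ⟨y, hy0, hy⟩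
  · obtain ⟨z, hz⟩ := exists_aeval_adicCompletion_eq_zero K v G a hx1 hx2
    exact ⟨z, 0, by rw [hz]; ring⟩
  · obtain ⟨b, rfl⟩ := Ideal.Quotient.mk_surjective y
    rw [Ideal.Quotient.eq_zero_iff_mem] at hy0
    rw [← map_pow, Ideal.Quotient.mk_eq_mk_iff_sub_mem] at hy
    obtain ⟨y, hy⟩ := exists_aeval_adicCompletion_eq_zero K v (X ^ 2 - C (G.eval a)) b
      (by simpa using hy) (by
        have : v.asIdeal.IsPrime := v.isPrime
        simp only [derivative_sub, derivative_X_pow, derivative_C, sub_zero, eval_mul, eval_pow,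
          eval_X, eval_C]
        intro h
        rcases Ideal.IsPrime.mem_or_mem this h with h | h
        · exact h2 (by simpa using h)
        · exact hy0 (by simpa using h))
    refine ⟨algebraMap R _ a, y, ?_⟩
    simp only [map_sub, map_pow, aeval_X, aeval_C] at hy
    rw [aeval_algebraMap_apply, coe_aeval_eq_eval]
    linear_combination hy

end Hensel

/-! ### The chart at infinity and the rational point -/

theorem aeval_homogenize_one_left {R A : Type*} [CommRing R] [CommRing A] [Algebra R A] (p : R[X])
    {n : ℕ} (hn : p.natDegree ≤ n) (z : A) :
    MvPolynomial.aeval ![1, z] (p.homogenize n) = aeval z (p.reflect n) := by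
  have h1 : p = ∑ i ∈ Finset.range (n + 1), monomial i (p.coeff i) :=
    as_sum_range' p (n + 1) (by omega)
  have h2 : p.reflect n = ∑ i ∈ Finset.range (n + 1), monomial (n - i) (p.coeff i) := by
    ext m
    rw [coeff_reflect, finsetSum_coeff]
    simp only [coeff_monomial]
    by_cases hm : m ≤ n
    · rw [revAt_le hm, Finset.sum_eq_single (n - m)]
      · rw [if_pos (by omega)]
      · intro i hi him
        rw [Finset.mem_range] at hi
        rw [if_neg (by omega)]
      · intro h
        exact absurd (Finset.mem_range.2 (by omega)) h
    · rw [revAt_eq_self_of_lt (by omega), coeff_eq_zero_of_natDegree_lt (by omega),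
        Finset.sum_eq_zero]
      intro i hi
      rw [if_neg (by omega)]
  rw [h2]
  conv_lhs => rw [h1]
  rw [homogenize_finsetSum, map_sum, map_sum]
  refine Finset.sum_congr rfl fun i hi => ?_
  rw [Finset.mem_range] at hi
  rw [homogenize_monomial (by omega), MvPolynomial.aeval_monomial, aeval_monomial]
  simp [Finsupp.prod_fintype, Fin.prod_univ_two]

theorem proposition3p3 {K : Type*} [Field K] [NumberField K]
    (𝔭 : IsDedekindDomain.HeightOneSpectrum (𝓞 K))
    (hodd : Odd (ringChar (𝓞 K ⧸ 𝔭.asIdeal)))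
    (g : ℕ) (hg : 1 ≤ g)
    (hq : 4 * (g : ℤ) ^ 2 - 2 < (Nat.card (𝓞 K ⧸ 𝔭.asIdeal) : ℤ))
    (f : (𝓞 K)[X])
    (hdeg : f.natDegree = 2 * g + 2)
    (hsqf : Squarefree (f.map (algebraMap (𝓞 K) K)))
    (hred : ¬ ∃ (c : (𝓞 K ⧸ 𝔭.asIdeal)ˣ) (h : (𝓞 K ⧸ 𝔭.asIdeal)[X]),
      ¬ IsSquare c ∧ f.map (Ideal.Quotient.mk 𝔭.asIdeal) = C (c : 𝓞 K ⧸ 𝔭.asIdeal) * h ^ 2) :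
    Nonempty (HyperellipticPoints g (f.map (algebraMap (𝓞 K) K)) (𝔭.adicCompletion K)) := by
  classical
  have hmax : 𝔭.asIdeal.IsMaximal := 𝔭.isMaximal
  let _ : Field (𝓞 K ⧸ 𝔭.asIdeal) := Ideal.Quotient.field 𝔭.asIdeal
  have : Finite (𝓞 K ⧸ 𝔭.asIdeal) := Ideal.finiteQuotientOfFreeOfNeBot _ 𝔭.ne_bot
  let _ : Fintype (𝓞 K ⧸ 𝔭.asIdeal) := Fintype.ofFinite _
  have hk : ringChar (𝓞 K ⧸ 𝔭.asIdeal) ≠ 2 := by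
    intro h
    rw [h] at hodd
    exact absurd hodd (by decide)
  have h2 : (2 : 𝓞 K) ∉ 𝔭.asIdeal := by
    rw [← Ideal.Quotient.eq_zero_iff_mem, map_ofNat]
    exact Ring.two_ne_zero hk
  rw [Nat.card_eq_fintype_card] at hq
  have hred' : ∀ (c : 𝓞 K ⧸ 𝔭.asIdeal) (h : (𝓞 K ⧸ 𝔭.asIdeal)[X]), ¬ IsSquare c →
      f.map (Ideal.Quotient.mk 𝔭.asIdeal) ≠ C c * h ^ 2 := by
    intro c h hc heq
    have hc0 : c ≠ 0 := by rintro rfl; exact hc (IsSquare.zero)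
    refine hred ⟨Units.mk0 c hc0, h, ?_, heq⟩
    rintro ⟨w, hw⟩
    exact hc ⟨w, by simpa using congrArg Units.val hw⟩
  have hdegK : (f.map (algebraMap (𝓞 K) K)).natDegree ≤ 2 * g + 2 := natDegree_map_le.trans hdeg.le
  rcases exists_smooth_point hk hg hq (natDegree_map_le.trans hdeg.le) hred' with ⟨x, hx⟩ | hx
  · obtain ⟨z, y, hzy⟩ := exists_sq_eq_aeval_adicCompletion K 𝔭 h2 f x hx
    refine ⟨Quotient.mk _ ⟨z, y, 1, by simp, ?_⟩⟩
    rw [aeval_homogenize_of_eq_one hdegK _ (by simp), hzy]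
    exact (aeval_map_algebraMap K z f).symm
  -- A smooth point at infinity is lifted in the chart X = 1, where the reversed polynomial is the
  -- right-hand side.
  · rw [reflect_map] at hx
    obtain ⟨z, y, hzy⟩ := exists_sq_eq_aeval_adicCompletion K 𝔭 h2 (f.reflect (2 * g + 2)) 0 hx
    refine ⟨Quotient.mk _ ⟨1, y, z, by simp, ?_⟩⟩
    rw [aeval_homogenize_one_left _ hdegK, reflect_map, hzy]
    exact (aeval_map_algebraMap K z _).symm
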